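/- Let $L,M,N$ be non-negative integers with $N\le L$ and $N\le M$, and let $\alpha,\Delta,u$ be non-zero complex numbers. Consider the square lattice formed by $L$ vertical and $M$ horizontal lines; vertical lines are counted from right to left and horizontal lines from top to bottom. An arrow configuration $\mathcal C$ assigns an arrow to every edge (including the external ones); an edge whose arrow points down or left is said to carry a line, the other edges are empty. The boundary conditions are: exactly the $N$ rightmost arrows on the top boundary and exactly the $N$ leftmost arrows on the bottom boundary point down, the other top and bottom boundary arrows point up, and all left and right boundary arrows point right. A vertex has the following Boltzmann weight at spectral parameter $v$: $w_1(v)=\frac{\alpha}{\Delta}\left(v-\frac1v\right)$ if all four edges are empty; $w_3(v)=v/\alpha$ if exactly the top and bottom edges carry lines; $w_4(v)=\alpha v$ if exactly the left and right edges carry lines; $w_5(v)=1$ if exactly the bottom and right edges carry lines; $w_6(v)=1$ if exactly the left and top edges carry lines; and weight $0$ in all other cases. For $u_1,\dots,u_L$ and non-zero $\xi_1,\dots,\xi_M$ the partition function of the five-vertex model is $$Z(u_1,\dots,u_L;\xi_1,\dots,\xi_M)=\sum_{\mathcal C}\prod_{j=1}^{L}\prod_{k=1}^{M}W_{j,k}(\mathcal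 C),$$ the sum being over the configurations that satisfy the boundary conditions, where $W_{j,k}(\mathcal C)$ is the weight, at spectral parameter $u_j/\xi_k$, of the vertex at the intersection of the $j$th vertical and the $k$th horizontal line. Let $Z=Z(u,\dots,u;1,\dots,1)$, the partition function of the homogeneous model; it is the limit of $Z(u_1,\dots,u_L;\xi_1,\dots,\xi_M)$ as $u_1,\dots,u_L\to u$ and $\xi_1,\dots,\xi_M\to1$. Put $x=u^2$, and read half-integer powers of $x$ as integer powers of $u$, $x^{k/2}=u^k$. Then $$Z=(-1)^{\frac{(L-N)(L-N-1)}{2}}\prod_{i=1}^{L-N}\frac{M!\,(M+i-1)!}{(M-N)!\,(M+L-N-1)!\,(N+i-1)!}\;\frac{\alpha^{M(L-2N)}}{\Delta^{(L-N)(M-N)}}\;x^{\frac{LM}{2}-\frac{(L-N)(L-N-3)}{2}}\det_{1\le i,j\le L-N}\left[(x\partial_x)^{i+j-2}\,\frac{(x-1)^{M+L-2N-1}}{x^{M+1}}\;{}_2F_1\!\left(-N,\,L-N-1;\,-M;\,x\right)\right],$$ and, if moreover $x\ne1$, $$Z=\prod_{i=1}^{N}\frac{(L+M-2N)!\,(M-N)!}{(M-N)!\,(L-i)!\,(M-i)!}\;\frac{\alpha^{M(L-2N)}}{\Delta^{(L-N)(M-N)}}\;x^{-\frac{L(M-2N)}{2}-\frac{N(N+1)}{2}}(x-1)^{ML}\det_{1\le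 i,j\le N}\left[(x\partial_x)^{i+j-2}\,\frac{x^{M-L+1}}{(x-1)^{M+L-2N+1}}\;{}_2F_1\!\left(-L+N+1,\,-L+N;\,-L-M+2N;\,1-x\right)\right].$$ Here the hypergeometric series ${}_2F_1$ terminate (a series with non-positive integer lower parameter is cut off where its upper parameters make it vanish), and a $0\times0$ determinant is $1$. -/

import Mathlib

open scoped BigOperators

namespace FiveVertex

noncomputable section

/-- Boltzmann weight of a vertex of the five-vertex model at spectral parameter `u`.
The arguments `left`, `bottom`, `top`, `right` describe the four edges adjacent to the vertex:
`true` means that the edge carries a line (its arrow points down or left), `false` that it is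
empty (its arrow points up or right).  In order, the five admissible vertices are those with
weights `w₁, w₃, w₄, w₅, w₆`.  Every other vertex (in particular the second vertex of the
six-vertex model, with all four edges occupied) is forbidden, i.e. has weight `0`. -/
def vertexWeight (α Δ u : ℂ) (left bottom top right : Bool) : ℂ :=
  match left, bottom, top, right with
  | false, false, false, false => α / Δ * (u - 1 / u)
  | false, true,  true,  false => u / α
  | true,  false, false, true  => α * u
  | false, true,  false, true  => 1
  | true,  false, true,  false => 1
  | _, _, _, _ => 0

/-- An assignment of arrows to all the edges of the lattice formed by `L` vertical and `M`
horizontal lines, with vertical lines counted from right to left and horizontal lines from top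
to bottom (both starting from `0`).  The vertical line `j` consists of the edges
`vert j 0, …, vert j M` from top to bottom, the horizontal line `k` of the edges
`horiz k 0, …, horiz k L` from right to left.  The value `true` stands for an arrow pointing down
or left (an edge carrying a line), `false` for an arrow pointing up or right. -/
structure Config (L M : ℕ) where
  /-- states of the vertical edges -/
  vert : Fin L → Fin (M + 1) → Bool
  /-- states of the horizontal edges -/
  horiz : Fin M → Fin (L + 1) → Bool

/-- Configurations are pairs of families of edge states. -/
def Config.equivProd (L M : ℕ) :
    (Fin L → Fin (M + 1) → Bool) × (Fin M → Fin (L + 1) → Bool) ≃ Config L M where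
  toFun p := ⟨p.1, p.2⟩
  invFun C := (C.vert, C.horiz)
  left_inv _ := rfl
  right_inv _ := rfl

instance (L M : ℕ) : Fintype (Config L M) :=
  Fintype.ofEquiv _ (Config.equivProd L M)

/-- The fixed boundary conditions: on the top boundary exactly the `N` rightmost arrows point
down, on the bottom boundary exactly the `N` leftmost arrows point down, and all arrows on the
right and left boundaries point right. -/
def Config.HasBoundary {L M : ℕ} (N : ℕ) (C : Config L M) : Prop :=
  (∀ j : Fin L, C.vert j 0 = true ↔ (j : ℕ) < N) ∧
  (∀ j : Fin L, C.vert j (Fin.last M) = true ↔ L ≤ (j : ℕ) + N) ∧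
  (∀ k : Fin M, C.horiz k 0 = false) ∧
  (∀ k : Fin M, C.horiz k (Fin.last L) = false)

/-- The weight `W_{j,k}(C)` of the vertex at the intersection of the `j`-th vertical and the
`k`-th horizontal line, with spectral parameter `u j / ξ k`. -/
def Config.localWeight {L M : ℕ} (C : Config L M) (α Δ : ℂ) (u : Fin L → ℂ) (ξ : Fin M → ℂ)
    (j : Fin L) (k : Fin M) : ℂ :=
  vertexWeight α Δ (u j / ξ k)
    (C.horiz k j.succ) (C.vert j k.succ) (C.vert j k.castSucc) (C.horiz k j.castSucc)

open Classical in
/-- The partition function of the inhomogeneous five-vertex model on the `L × M` lattice. -/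
def partitionFunction (L M N : ℕ) (α Δ : ℂ) (u : Fin L → ℂ) (ξ : Fin M → ℂ) : ℂ :=
  ∑ C : Config L M with C.HasBoundary N,
    ∏ j : Fin L, ∏ k : Fin M, C.localWeight α Δ u ξ j k

/-- The partition function of the homogeneous model: all `u j` equal `u`, all `ξ k` equal `1`. -/
def homPartitionFunction (L M N : ℕ) (α Δ u : ℂ) : ℂ :=
  partitionFunction L M N α Δ (fun _ => u) (fun _ => 1)

/-- The differential operator `x ∂ₓ`. -/
def eulerOp (f : ℂ → ℂ) : ℂ → ℂ := fun x => x * deriv f x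

/-- The Hankel determinant `det_{1 ≤ i, j ≤ n} [(x ∂ₓ)^(i + j - 2) f]`, evaluated at `x`
(the indices below start from `0`). -/
def hankelDet (n : ℕ) (f : ℂ → ℂ) (x : ℂ) : ℂ :=
  Matrix.det (Matrix.of fun i j : Fin n => eulerOp^[(i : ℕ) + (j : ℕ)] f x)

/-- The function under `(x ∂ₓ)^(i + j - 2)` in the `(L - N) × (L - N)` determinant. -/
def symbol₁ (L M N : ℕ) (x : ℂ) : ℂ :=
  (x - 1) ^ ((M : ℤ) + L - 2 * N - 1) / x ^ (M + 1) *
    ordinaryHypergeometric (-(N : ℂ)) ((L : ℂ) - N - 1) (-(M : ℂ)) x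

/-- The function under `(x ∂ₓ)^(i + j - 2)` in the `N × N` determinant. -/
def symbol₂ (L M N : ℕ) (x : ℂ) : ℂ :=
  x ^ ((M : ℤ) - L + 1) / (x - 1) ^ ((M : ℤ) + L - 2 * N + 1) *
    ordinaryHypergeometric (-(L : ℂ) + N + 1) (-(L : ℂ) + N) (-(L : ℂ) - M + 2 * N) (1 - x)

end

end FiveVertex

open FiveVertex

/-! Write `d = L - N`, `b = M - N`, `x = u ^ 2`. The model is free-fermionic: after suitable vectors
are attached to the lines, a row state becomes an exterior product, and one row of the lattice only
replaces the vectors by new ones. The vanishing weight of the fully occupied vertex is what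
antisymmetry encodes. This is `sum_prefixWeight_smul_wedgeState`; iterating it over the rows and
applying a determinant functional gives `homPartitionFunction_eq_det`, one `N × N` determinant in
the vectors after `M` rows.

The vectors are coefficients of power series `E ^ (n - i - 1) * φ ^ k * ψ ^ (i + 1 - N)`. The
transfer relations reduce to `φ * (E - x X) = ψ` and `ψ * (φ - 1) = X * φ`, and the initial state
requires `E` to be linear in `X`. Two solutions are used. With `ψ = 1`, `φ = (1 - X)⁻¹`, `E = 1 - (1
- x) X` one obtains an `N × N` Toeplitz determinant (`homPartitionFunction_eq_toeplitz`). With `φ =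
ψ = 1 + X`, `E = 1 + x X` one obtains another, and the duality between minors of the Toeplitz
matrices of a series and of its inverse (`det_toeplitz_eq_det_toeplitz_inv`) turns it into a `d × d`
one (`homPartitionFunction_eq_toeplitz_complement`).

On the other side, the terminating hypergeometric functions are, up to a binomial coefficient, the
coefficients of `(1 - z X) ^ (-p) * (1 - X) ^ (-q)` (`choose_mul_hypergeometric`). Their contiguity
relations make operators `x ∂ₓ - const` act as ladder operators on `p`, `q` and the degree.
Replacing powers of `x ∂ₓ` by monic products of such operators does not change a Hankel determinant,
so `hankelDet_eq_mul_det` removes all derivatives; triangular row and column operations then lead to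
the same Toeplitz determinants. What remains is bookkeeping of factorials and monomials.

All this divides by the weight of the empty vertex, which vanishes exactly at `x = 1`; the `d × d`
formula is extended there by continuity. -/

namespace FiveVertex

/-! ### Generating series of products of two binomial powers -/

section Series

open PowerSeries

/-- The coefficient `p (p + 1) ⋯ (p + m - 1) / m!` of `X ^ m` in `(1 - X) ^ (-p)`. -/
noncomputable def risingCoeff (p : ℂ) (m : ℕ) : ℂ :=
  (ascPochhammer ℂ m).eval p / m.factorial

@[simp] lemma risingCoeff_zero_right (p : ℂ) : risingCoeff p 0 = 1 := by
  simp [risingCoeff]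

lemma risingCoeff_succ_mul (p : ℂ) (m : ℕ) :
    ((m : ℂ) + 1) * risingCoeff p (m + 1) = (p + m) * risingCoeff p m := by
  have h : ((m.factorial : ℕ) : ℂ) ≠ 0 := by exact_mod_cast m.factorial_ne_zero
  have h' : (m : ℂ) + 1 ≠ 0 := by exact_mod_cast m.succ_ne_zero
  simp only [risingCoeff, ascPochhammer_succ_eval, Nat.factorial_succ, Nat.cast_mul, Nat.cast_succ]
  field_simp

lemma mul_risingCoeff_add_one (p : ℂ) (m : ℕ) :
    p * risingCoeff (p + 1) m = (p + m) * risingCoeff p m := by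
  induction m with
  | zero => simp
  | succ m ih =>
    have h' : (m : ℂ) + 1 ≠ 0 := by exact_mod_cast m.succ_ne_zero
    apply mul_left_cancel₀ h'
    have h1 := risingCoeff_succ_mul (p + 1) m
    have h2 := risingCoeff_succ_mul p m
    push_cast
    linear_combination p * h1 + (p + m + 1) * ih - (p + m + 1) * h2

lemma risingCoeff_add_one_succ (p : ℂ) (m : ℕ) :
    risingCoeff (p + 1) (m + 1) = risingCoeff p (m + 1) + risingCoeff (p + 1) m := by
  have h' : (m : ℂ) + 1 ≠ 0 := by exact_mod_cast m.succ_ne_zero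
  apply mul_left_cancel₀ h'
  have h1 := risingCoeff_succ_mul (p + 1) m
  have h2 := risingCoeff_succ_mul p m
  have h3 := mul_risingCoeff_add_one p m
  linear_combination h1 - h2 + h3

lemma risingCoeff_zero_left_succ (m : ℕ) : risingCoeff 0 (m + 1) = 0 := by
  simp [risingCoeff]

/-- The power series `1 - z X`, as a unit. -/
noncomputable def linUnit (z : ℂ) : ℂ⟦X⟧ˣ :=
  (PowerSeries.isUnit_iff_constantCoeff.2 (by simp) : IsUnit (1 - C z * X : ℂ⟦X⟧)).unit

@[simp] lemma val_linUnit (z : ℂ) : ((linUnit z : ℂ⟦X⟧ˣ) : ℂ⟦X⟧) = 1 - C z * X := rfl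

lemma mk_risingCoeff_mul (z p : ℂ) :
    (PowerSeries.mk fun r => risingCoeff (p + 1) r * z ^ r) * (1 - C z * X) =
      PowerSeries.mk fun r => risingCoeff p r * z ^ r := by
  ext n
  rw [mul_sub, mul_one, ← mul_assoc, map_sub]
  cases n with
  | zero => simp
  | succ n =>
    rw [PowerSeries.coeff_succ_mul_X, mul_comm _ (C z), PowerSeries.coeff_C_mul]
    simp only [coeff_mk, risingCoeff_add_one_succ]
    ring

/-- Multiplication by `1 - z X` lowers `p` by one, by Pascal's rule; since `1 - z X` is a unit, this
propagates from `p = 0` to all integers in both directions. -/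
lemma val_linUnit_zpow_neg (z : ℂ) (p : ℤ) :
    ((linUnit z ^ (-p) : ℂ⟦X⟧ˣ) : ℂ⟦X⟧) = PowerSeries.mk fun r => risingCoeff p r * z ^ r := by
  have key : ∀ p : ℤ, (PowerSeries.mk fun r => risingCoeff (p + 1 : ℤ) r * z ^ r) *
      (linUnit z : ℂ⟦X⟧) = PowerSeries.mk fun r => risingCoeff p r * z ^ r := by
    intro p
    have := mk_risingCoeff_mul z p
    push_cast
    exact this
  induction p with
  | zero =>
    ext n
    cases n with
    | zero => simp
    | succ n => simp [risingCoeff_zero_left_succ, PowerSeries.coeff_one]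
  | succ n ih =>
    apply (linUnit z).isUnit.mul_right_cancel
    rw [key, ← ih, ← Units.val_mul, ← zpow_add_one]
    congr 2
    ring
  | pred n ih =>
    rw [← key, sub_add_cancel, ← ih, ← Units.val_mul, ← zpow_add_one]
    congr 2
    ring

/-- The polynomial in `z` which is the coefficient of `X ^ n` in
`(1 - z X) ^ (-p) (1 - X) ^ (-q)`. -/
noncomputable def binomialPoly (p q : ℂ) (n : ℕ) : Polynomial ℂ :=
  ∑ r ∈ Finset.range (n + 1), Polynomial.monomial r (risingCoeff p r * risingCoeff q (n - r))

lemma coeff_binomialPoly_add (p q : ℂ) (r m : ℕ) :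
    (binomialPoly p q (r + m)).coeff r = risingCoeff p r * risingCoeff q m := by
  rw [binomialPoly, Polynomial.finsetSum_coeff, Finset.sum_eq_single r]
  · simp
  · intro b _ hb
    rw [Polynomial.coeff_monomial, if_neg hb]
  · intro h
    exact absurd (Finset.mem_range.2 (by omega)) h

lemma coeff_binomialPoly_of_lt (p q : ℂ) {r n : ℕ} (h : n < r) :
    (binomialPoly p q n).coeff r = 0 := by
  rw [binomialPoly, Polynomial.finsetSum_coeff]
  refine Finset.sum_eq_zero fun b hb => ?_
  rw [Polynomial.coeff_monomial, if_neg]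
  rintro rfl
  exact absurd (Finset.mem_range.1 hb) (by omega)

lemma coeff_linUnit_zpow_mul (z : ℂ) (p q : ℤ) (n : ℕ) :
    coeff n ((linUnit z ^ (-p) * linUnit 1 ^ (-q) : ℂ⟦X⟧ˣ) : ℂ⟦X⟧) =
      (binomialPoly p q n).eval z := by
  rw [Units.val_mul, val_linUnit_zpow_neg, val_linUnit_zpow_neg, PowerSeries.coeff_mul,
    binomialPoly, Polynomial.eval_finsetSum,
    Finset.Nat.sum_antidiagonal_eq_sum_range_succ_mk]
  refine Finset.sum_congr rfl fun r _ => ?_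
  simp only [coeff_mk, one_pow, mul_one, Polynomial.eval_monomial]
  ring

end Series

/-! ### Contiguity relations for the coefficients of these series -/

section Contiguity

open Polynomial

lemma coeff_X_mul_derivative (f : ℂ[X]) (r : ℕ) :
    (X * derivative f).coeff r = r * f.coeff r := by
  cases r with
  | zero => simp
  | succ r => rw [coeff_X_mul, coeff_derivative]; push_cast; ring

/-- A linear first-order differential expression in `f`, coefficient by coefficient. -/
lemma coeff_eulerExpr (f : ℂ[X]) (A B c : ℂ) (r : ℕ) :
    (C A * X * f + C B * f + C c * (X - 1) * (X * derivative f)).coeff (r + 1) =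
      (A + c * r) * f.coeff r + (B - c * (r + 1)) * f.coeff (r + 1) := by
  have e : C A * X * f + C B * f + C c * (X - 1) * (X * derivative f) =
      X * (C A * f + C c * (X * derivative f)) + (C B * f - C c * (X * derivative f)) := by ring
  rw [e, coeff_add, coeff_X_mul, coeff_add, coeff_sub, coeff_C_mul, coeff_C_mul, coeff_C_mul,
    coeff_C_mul, coeff_X_mul_derivative, coeff_X_mul_derivative]
  push_cast
  ring

lemma coeff_zero_eulerExpr (f : ℂ[X]) (A B c : ℂ) :
    (C A * X * f + C B * f + C c * (X - 1) * (X * derivative f)).coeff 0 = B * f.coeff 0 := by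
  simp [mul_coeff_zero]

/-- An identity between a first-order differential expression in `binomialPoly p q n` and another
such polynomial can be checked coefficient by coefficient. -/
lemma eulerExpr_binomialPoly_eq {p q p' q' A B c e : ℂ} {n n' : ℕ} (hn : n ≤ n') (hn' : n' ≤ n + 1)
    (h0 : B * risingCoeff q n = e * risingCoeff q' n')
    (hlt : ∀ r m : ℕ, r + 1 + m = n →
      (A + c * r) * (risingCoeff p r * risingCoeff q (m + 1)) +
        (B - c * (r + 1)) * (risingCoeff p (r + 1) * risingCoeff q m) =
      e * (risingCoeff p' (r + 1) * risingCoeff q' (n' - (r + 1))))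
    (hlast : (A + c * n) * risingCoeff p n =
      if n' = n then 0 else e * risingCoeff p' (n + 1)) :
    C A * X * binomialPoly p q n + C B * binomialPoly p q n +
        C c * (X - 1) * (X * derivative (binomialPoly p q n)) = C e * binomialPoly p' q' n' := by
  ext r
  rw [coeff_C_mul]
  cases r with
  | zero =>
    have h1 := coeff_binomialPoly_add p q 0 n
    have h2 := coeff_binomialPoly_add p' q' 0 n'
    rw [zero_add] at h1 h2
    rw [coeff_zero_eulerExpr, h1, h2]
    simpa using h0
  | succ r =>
    rw [coeff_eulerExpr]
    -- Below degree `n` both coefficients of the old polynomial occur; at the top only the shifted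
    -- one survives, and whether the right side reaches degree `n + 1` depends on `n'`.
    rcases lt_trichotomy r n with h | h | h
    · obtain ⟨m, rfl⟩ := Nat.exists_eq_add_of_le (Nat.succ_le_of_lt h)
      obtain ⟨m', rfl⟩ := Nat.exists_eq_add_of_le (show r + 1 ≤ n' by omega)
      rw [Nat.succ_eq_add_one, coeff_binomialPoly_add, coeff_binomialPoly_add,
        show r + 1 + m = r + (m + 1) by ring, coeff_binomialPoly_add]
      have := hlt r m (by omega)
      rwa [Nat.add_sub_cancel_left] at this
    · subst h
      rw [coeff_binomialPoly_of_lt p q (Nat.lt_succ_self r)]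
      have h1 := coeff_binomialPoly_add p q r 0
      rw [add_zero] at h1
      rw [h1]
      split_ifs at hlast with h2
      · subst h2
        rw [coeff_binomialPoly_of_lt _ _ (Nat.lt_succ_self _)]
        simp [hlast]
      · obtain rfl : n' = r + 1 := by omega
        have h3 := coeff_binomialPoly_add p' q' (r + 1) 0
        rw [add_zero] at h3
        rw [h3]
        simp [hlast]
    · rw [coeff_binomialPoly_of_lt _ _ h, coeff_binomialPoly_of_lt _ _ (by omega),
        coeff_binomialPoly_of_lt _ _ (by omega)]
      ring

/-- Row ladder for the `d × d` Hankel determinant: one step sends `(q, n)` to `(q - 1, n + 1)`. -/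
lemma eulerExpr_binomialPoly_raise_degree_lower (p q : ℂ) (n : ℕ) :
    C p * X * binomialPoly p q n + C (q - 1) * binomialPoly p q n +
        C 1 * (X - 1) * (X * derivative (binomialPoly p q n)) =
      C ((n : ℂ) + 1) * binomialPoly p (q - 1) (n + 1) := by
  have hq : ∀ m : ℕ, (q - 1) * risingCoeff q m = (m + 1) * risingCoeff (q - 1) (m + 1) := by
    intro m
    have h1 := mul_risingCoeff_add_one (q - 1) m
    have h2 := risingCoeff_succ_mul (q - 1) m
    rw [sub_add_cancel] at h1
    rw [h1, h2]
  apply eulerExpr_binomialPoly_eq (by omega) (by omega)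
  · exact hq n
  · intro r m h
    have h1 := risingCoeff_succ_mul p r
    have h2 := risingCoeff_add_one_succ (q - 1) m
    rw [sub_add_cancel] at h2
    have hn : (n : ℂ) = r + 1 + m := by rw [← h]; push_cast; ring
    rw [show n + 1 - (r + 1) = m + 1 by omega, hn]
    linear_combination (-risingCoeff q (m + 1)) * h1 +
      ((r : ℂ) + 1) * risingCoeff p (r + 1) * h2 + risingCoeff p (r + 1) * hq m
  · rw [if_neg (by omega), risingCoeff_succ_mul]
    ring

/-- Column ladder for the `d × d` Hankel determinant. The constant depends on `q` and `n` only
through `n + q`, which the row ladder preserves; hence it is the same in every row. -/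
lemma eulerExpr_binomialPoly_lower_left (p q : ℂ) (n : ℕ) :
    C (-n : ℂ) * X * binomialPoly p q n + C (n + q + p - 1) * binomialPoly p q n +
        C 1 * (X - 1) * (X * derivative (binomialPoly p q n)) =
      C ((n : ℂ) + q + p - 1) * binomialPoly (p - 1) q n := by
  apply eulerExpr_binomialPoly_eq (by omega) (by omega)
  · ring
  · intro r m h
    have h1 := risingCoeff_add_one_succ (p - 1) r
    rw [sub_add_cancel] at h1
    have h2 := mul_risingCoeff_add_one (p - 1) (r + 1)
    rw [sub_add_cancel] at h2
    have h3 := risingCoeff_succ_mul q m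
    have hn : (n : ℂ) = r + 1 + m := by rw [← h]; push_cast; ring
    rw [show n - (r + 1) = m by omega, hn]
    push_cast at h2
    linear_combination (-risingCoeff p r) * h3 + (q + m) * risingCoeff q m * h1 +
      risingCoeff q m * h2
  · rw [if_pos rfl]
    ring

/-- Row ladder for the `N × N` Hankel determinant. -/
lemma eulerExpr_binomialPoly_raise_degree (p q : ℂ) (n : ℕ) :
    C p * X * binomialPoly p q n + C (n + q) * binomialPoly p q n +
        C 1 * (X - 1) * (X * derivative (binomialPoly p q n)) =
      C ((n : ℂ) + 1) * binomialPoly p q (n + 1) := by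
  apply eulerExpr_binomialPoly_eq (by omega) (by omega)
  · rw [risingCoeff_succ_mul]; ring
  · intro r m h
    have h1 := risingCoeff_succ_mul p r
    have h2 := risingCoeff_succ_mul q m
    have hn : (n : ℂ) = r + 1 + m := by rw [← h]; push_cast; ring
    rw [show n + 1 - (r + 1) = m + 1 by omega, hn]
    linear_combination (-risingCoeff q (m + 1)) * h1 - risingCoeff p (r + 1) * h2
  · rw [if_neg (by omega), risingCoeff_succ_mul]
    ring

/-- Column ladder for the `N × N` Hankel determinant; `p + q` is preserved. -/
lemma eulerExpr_binomialPoly_lower_left_raise_right (p q : ℂ) (n : ℕ) :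
    C (-n : ℂ) * X * binomialPoly p q n + C (n + q) * binomialPoly p q n +
        C 1 * (X - 1) * (X * derivative (binomialPoly p q n)) =
      C q * binomialPoly (p - 1) (q + 1) n := by
  apply eulerExpr_binomialPoly_eq (by omega) (by omega)
  · rw [mul_risingCoeff_add_one]; ring
  · intro r m h
    have h1 := risingCoeff_add_one_succ (p - 1) r
    rw [sub_add_cancel] at h1
    have h2 := mul_risingCoeff_add_one q m
    have h3 := risingCoeff_succ_mul q m
    have hn : (n : ℂ) = r + 1 + m := by rw [← h]; push_cast; ring
    rw [show n - (r + 1) = m by omega, hn]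
    linear_combination (-risingCoeff p r) * h3 + (q + m) * risingCoeff q m * h1 -
      risingCoeff (p - 1) (r + 1) * h2
  · rw [if_pos rfl]
    ring

end Contiguity

/-! ### Terminating hypergeometric functions as binomial polynomials -/

lemma risingCoeff_natCast_add_one (m n : ℕ) :
    risingCoeff ((m : ℂ) + 1) n = ((m + n).choose n : ℂ) := by
  have h : ((n.factorial : ℕ) : ℂ) ≠ 0 := by exact_mod_cast n.factorial_ne_zero
  have h1 := Nat.ascFactorial_eq_factorial_mul_choose m n
  rw [← ascPochhammer_nat_eq_ascFactorial] at h1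
  have h2 : (ascPochhammer ℂ n).eval ((m : ℂ) + 1) = ((ascPochhammer ℕ n).eval (m + 1) : ℕ) := by
    rw [ascPochhammer_eval_cast]
    push_cast
    rfl
  rw [risingCoeff, h2, h1]
  push_cast
  field_simp

lemma choose_mul_ascPochhammer_div {n M r : ℕ} (h : n ≤ M) (hr : r ≤ n) :
    (M.choose n : ℂ) * (ascPochhammer ℂ r).eval (-(n : ℂ)) *
      ((ascPochhammer ℂ r).eval (-(M : ℂ)))⁻¹ = risingCoeff ((M : ℂ) - n + 1) (n - r) := by
  induction r with
  | zero =>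
    have := risingCoeff_natCast_add_one (M - n) n
    rw [Nat.cast_sub h, Nat.sub_add_cancel h] at this
    simp [this]
  | succ r ih =>
    obtain ⟨m, rfl⟩ := Nat.exists_eq_add_of_le hr
    have h1 := risingCoeff_succ_mul ((M : ℂ) - (r + 1 + m : ℕ) + 1) m
    specialize ih (by omega)
    rw [show r + 1 + m - r = m + 1 by omega] at ih
    rw [show r + 1 + m - (r + 1) = m by omega]
    have h2 : (M : ℂ) - r ≠ 0 := by
      rw [sub_ne_zero]
      exact_mod_cast (by omega : M ≠ r)
    rw [← ih] at h1
    rw [ascPochhammer_succ_eval, ascPochhammer_succ_eval, mul_inv]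
    have h3 : (-(M : ℂ) + r)⁻¹ = -((M : ℂ) - r)⁻¹ := by rw [← inv_neg]; congr 1; ring
    rw [h3]
    apply mul_left_cancel₀ h2
    push_cast at h1 ⊢
    field_simp
    linear_combination h1

/-- The numerator symbol of `-n` cuts the series off after degree `n`, and `n ≤ M` keeps the
denominators non-zero up to there; the binomial factor turns the quotient of Pochhammer symbols into
a rising coefficient. -/
lemma choose_mul_hypergeometric {n M : ℕ} (h : n ≤ M) (p z : ℂ) :
    (M.choose n : ℂ) * ordinaryHypergeometric (-(n : ℂ)) p (-(M : ℂ)) z =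
      (binomialPoly p ((M : ℂ) - n + 1) n).eval z := by
  rw [ordinaryHypergeometric, ordinaryHypergeometric_sum_eq, tsum_eq_sum (s := Finset.range (n + 1)),
    binomialPoly, Polynomial.eval_finsetSum, Finset.mul_sum]
  · refine Finset.sum_congr rfl fun r hr => ?_
    rw [Polynomial.eval_monomial,
      ← choose_mul_ascPochhammer_div h (Nat.lt_succ_iff.1 (Finset.mem_range.1 hr)),
      risingCoeff, smul_eq_mul]
    ring
  · intro r hr
    have : (ascPochhammer ℂ r).eval (-(n : ℂ)) = 0 :=
      (ascPochhammer_eval_eq_zero_iff r _).2 ⟨n, by simpa using hr, by simp⟩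
    simp [this]

/-! ### Hankel determinants and ladder operators -/

section Hankel

lemma eulerOp_iterate_analyticOnNhd {U : Set ℂ} {f : ℂ → ℂ} (hf : AnalyticOnNhd ℂ f U) (n : ℕ) :
    AnalyticOnNhd ℂ (eulerOp^[n] f) U := by
  induction n with
  | zero => exact hf
  | succ n ih =>
    rw [Function.iterate_succ_apply']
    exact analyticOnNhd_id.mul ih.deriv

lemma eulerOp_eqOn {U : Set ℂ} (hU : IsOpen U) {f g : ℂ → ℂ} (h : Set.EqOn f g U) :
    Set.EqOn (eulerOp f) (eulerOp g) U := fun x hx => by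
  simp only [eulerOp]
  rw [(h.eventuallyEq_of_mem (hU.mem_nhds hx)).deriv_eq]

lemma eulerOp_iterate_eqOn {U : Set ℂ} (hU : IsOpen U) {f g : ℂ → ℂ} (h : Set.EqOn f g U) (n : ℕ) :
    Set.EqOn (eulerOp^[n] f) (eulerOp^[n] g) U := by
  induction n with
  | zero => exact h
  | succ n ih =>
    rw [Function.iterate_succ_apply', Function.iterate_succ_apply']
    exact eulerOp_eqOn hU ih

lemma eulerOp_iterate_linear {U : Set ℂ} (hU : IsOpen U) {f g : ℂ → ℂ} (hf : AnalyticOnNhd ℂ f U)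
    (hg : AnalyticOnNhd ℂ g U) (c : ℂ) (n : ℕ) :
    Set.EqOn (eulerOp^[n] fun x => f x + c * g x)
      (fun x => eulerOp^[n] f x + c * eulerOp^[n] g x) U := by
  induction n with
  | zero => intro x _; rfl
  | succ n ih =>
    intro x hx
    simp only [Function.iterate_succ_apply']
    rw [eulerOp_eqOn hU ih hx]
    have h1 := (eulerOp_iterate_analyticOnNhd hf n x hx).differentiableAt
    have h2 := (eulerOp_iterate_analyticOnNhd hg n x hx).differentiableAt
    simp only [eulerOp]
    rw [deriv_fun_add h1 (h2.const_mul c), deriv_const_mul c h2]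
    ring

/-- The value at `x` of `P (x ∂ₓ) f`. -/
noncomputable def applyEuler (f : ℂ → ℂ) (x : ℂ) (P : Polynomial ℂ) : ℂ :=
  P.sum fun n a => a * eulerOp^[n] f x

lemma applyEuler_X_pow (f : ℂ → ℂ) (x : ℂ) (n : ℕ) :
    applyEuler f x (Polynomial.X ^ n) = eulerOp^[n] f x := by
  rw [applyEuler, ← Polynomial.monomial_one_right_eq_X_pow, Polynomial.sum_monomial_index]
  · simp
  · simp

lemma applyEuler_add (f : ℂ → ℂ) (x : ℂ) (P Q : Polynomial ℂ) :
    applyEuler f x (P + Q) = applyEuler f x P + applyEuler f x Q :=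
  Polynomial.sum_add_index P Q _ (by simp) (by intros; ring)

lemma applyEuler_C_mul (f : ℂ → ℂ) (x c : ℂ) (P : Polynomial ℂ) :
    applyEuler f x (Polynomial.C c * P) = c * applyEuler f x P := by
  rw [applyEuler, applyEuler, ← Polynomial.smul_eq_C_mul,
    Polynomial.sum_smul_index _ _ _ (by simp), Polynomial.sum, Polynomial.sum, Finset.mul_sum]
  exact Finset.sum_congr rfl fun _ _ => by ring

/-- Polynomials in `x ∂ₓ` commute, so a ladder factor may act first. The relation must hold on an
open set, since it is differentiated further. -/
lemma applyEuler_mul_X_sub_C {U : Set ℂ} (hU : IsOpen U) {f g : ℂ → ℂ}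
    (hf : AnalyticOnNhd ℂ f U) {p c : ℂ}
    (h : ∀ x ∈ U, eulerOp f x - p * f x = c * g x) {x : ℂ} (hx : x ∈ U) (hg : AnalyticOnNhd ℂ g U)
    (P : Polynomial ℂ) :
    applyEuler f x (P * (Polynomial.X - Polynomial.C p)) = c * applyEuler g x P := by
  induction P using Polynomial.induction_on' with
  | add P Q hP hQ => rw [add_mul, applyEuler_add, applyEuler_add, hP, hQ]; ring
  | monomial n a =>
    have e1 : eulerOp^[n + 1] f x = p * eulerOp^[n] f x + c * eulerOp^[n] g x := by
      have h0 : Set.EqOn (eulerOp f) (fun x => (fun y => 0 + p * f y) x + c * g x) U := by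
        intro y hy
        have := h y hy
        simp only
        linear_combination this
      have hf' : AnalyticOnNhd ℂ (fun y => 0 + p * f y) U :=
        analyticOnNhd_const.add (analyticOnNhd_const.mul hf)
      rw [Function.iterate_succ_apply, eulerOp_iterate_eqOn hU h0 n hx,
        eulerOp_iterate_linear hU hf' hg c n hx]
      have h1 := eulerOp_iterate_linear hU (analyticOnNhd_const (v := (0 : ℂ))) hf p n hx
      simp only at h1 ⊢
      rw [h1]
      have h2 := eulerOp_iterate_linear hU (analyticOnNhd_const (v := (0 : ℂ)))
        (analyticOnNhd_const (v := (0 : ℂ))) (-1) n hx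
      have h3 : eulerOp^[n] (fun _ => (0 : ℂ)) x = 0 := by
        simp only [mul_zero, add_zero] at h2
        linear_combination h2
      rw [h3, zero_add]
    rw [← Polynomial.C_mul_X_pow_eq_monomial, mul_assoc, applyEuler_C_mul, applyEuler_C_mul,
      applyEuler_X_pow, mul_sub, ← pow_succ, sub_eq_add_neg, applyEuler_add, applyEuler_X_pow,
      show -(Polynomial.X ^ n * Polynomial.C p) = Polynomial.C (-p) * Polynomial.X ^ n by
        rw [Polynomial.C_neg]; ring,
      applyEuler_C_mul, applyEuler_X_pow, e1]
    ring

lemma applyEuler_eq_sum {n : ℕ} (f : ℂ → ℂ) (x : ℂ) {P Q : Polynomial ℂ}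
    (hP : P.natDegree < n) (hQ : Q.natDegree < n) :
    applyEuler f x (P * Q) =
      ∑ k : Fin n, ∑ l : Fin n, P.coeff k * eulerOp^[(k : ℕ) + l] f x * Q.coeff l := by
  have hsum : ∀ (s : Finset ℕ) (F : ℕ → Polynomial ℂ),
      applyEuler f x (∑ k ∈ s, F k) = ∑ k ∈ s, applyEuler f x (F k) := by
    intro s F
    induction s using Finset.induction_on with
    | empty => simp [applyEuler]
    | insert a s ha ih => rw [Finset.sum_insert ha, Finset.sum_insert ha, applyEuler_add, ih]
  rw [P.as_sum_range' n hP, Q.as_sum_range' n hQ, Finset.sum_mul_sum, hsum,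
    ← P.as_sum_range' n hP, ← Q.as_sum_range' n hQ, Finset.sum_range]
  refine Finset.sum_congr rfl fun k _ => ?_
  rw [hsum, Finset.sum_range]
  refine Finset.sum_congr rfl fun l _ => ?_
  rw [Polynomial.monomial_mul_monomial, ← Polynomial.C_mul_X_pow_eq_monomial, applyEuler_C_mul,
    applyEuler_X_pow]
  ring

/-- A Hankel determinant does not change when the powers of `x ∂ₓ` are replaced by monic
polynomials in `x ∂ₓ`; here the polynomials are products of ladder operators. -/
theorem hankelDet_eq_mul_det {U : Set ℂ} (hU : IsOpen U) (n : ℕ) (f : ℕ → ℕ → ℂ → ℂ)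
    (p q c e : ℕ → ℂ) (hf : ∀ i j, AnalyticOnNhd ℂ (f i j) U)
    (hrow : ∀ i j, ∀ x ∈ U, eulerOp (f i j) x - p i * f i j x = c i * f (i + 1) j x)
    (hcol : ∀ i j, ∀ x ∈ U, eulerOp (f i j) x - q j * f i j x = e j * f i (j + 1) x)
    {x : ℂ} (hx : x ∈ U) :
    hankelDet n (f 0 0) x =
      (∏ i ∈ Finset.range n, ∏ s ∈ Finset.range i, c s) *
      (∏ j ∈ Finset.range n, ∏ s ∈ Finset.range j, e s) *
      Matrix.det (Matrix.of fun i j : Fin n => f i j x) := by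
  let P : ℕ → Polynomial ℂ := fun i => ∏ s ∈ Finset.range i, (Polynomial.X - Polynomial.C (p s))
  let Q : ℕ → Polynomial ℂ := fun i => ∏ s ∈ Finset.range i, (Polynomial.X - Polynomial.C (q s))
  have hP : ∀ (i j : ℕ) (R : Polynomial ℂ), applyEuler (f 0 j) x (R * P i) =
      (∏ s ∈ Finset.range i, c s) * applyEuler (f i j) x R := by
    intro i j
    induction i with
    | zero => simp [P]
    | succ i ih =>
      intro R
      have : R * P (i + 1) = R * (Polynomial.X - Polynomial.C (p i)) * P i := by
        simp only [P, Finset.prod_range_succ]; ring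
      rw [this, ih, applyEuler_mul_X_sub_C hU (hf i j) (hrow i j) hx (hf (i + 1) j),
        Finset.prod_range_succ]
      ring
  have hQ : ∀ (j : ℕ) (R : Polynomial ℂ), applyEuler (f 0 0) x (R * Q j) =
      (∏ s ∈ Finset.range j, e s) * applyEuler (f 0 j) x R := by
    intro j
    induction j with
    | zero => simp [Q]
    | succ j ih =>
      intro R
      have : R * Q (j + 1) = R * (Polynomial.X - Polynomial.C (q j)) * Q j := by
        simp only [Q, Finset.prod_range_succ]; ring
      rw [this, ih, applyEuler_mul_X_sub_C hU (hf 0 j) (hcol 0 j) hx (hf 0 (j + 1)),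
        Finset.prod_range_succ]
      ring
  have hPQ : ∀ i j : ℕ, applyEuler (f 0 0) x (P i * Q j) =
      (∏ s ∈ Finset.range i, c s) * ((∏ s ∈ Finset.range j, e s) * f i j x) := by
    intro i j
    have h1 : applyEuler (f i j) x 1 = f i j x := by
      have := applyEuler_X_pow (f i j) x 0
      simpa using this
    rw [hQ, ← one_mul (P i), hP, h1]
    ring
  have hPm : ∀ (r : ℕ → ℂ) (i : ℕ),
      (∏ s ∈ Finset.range i, (Polynomial.X - Polynomial.C (r s))).Monic := fun r i =>
    Polynomial.monic_prod_of_monic _ _ fun s _ => Polynomial.monic_X_sub_C _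
  have hPd : ∀ (r : ℕ → ℂ) (i : ℕ),
      (∏ s ∈ Finset.range i, (Polynomial.X - Polynomial.C (r s))).natDegree = i := by
    intro r i
    rw [Polynomial.natDegree_prod_of_monic _ _ fun s _ => Polynomial.monic_X_sub_C _]
    simp
  have hdetP := Matrix.det_matrixOfPolynomials (fun i : Fin n => P i)
    (fun i => hPd p i) (fun i => hPm p i)
  have hdetQ := Matrix.det_matrixOfPolynomials (fun i : Fin n => Q i)
    (fun i => hPd q i) (fun i => hPm q i)
  -- Passing from powers to the monic polynomials `P i`, `Q j` multiplies the Hankel matrix on both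
  -- sides by coefficient matrices of determinant `1`.
  have hmat : (Matrix.of fun i j : Fin n => applyEuler (f 0 0) x (P i * Q j)) =
      (Matrix.of fun i j : Fin n => (P j).coeff i).transpose *
        (Matrix.of fun i j : Fin n => eulerOp^[(i : ℕ) + (j : ℕ)] (f 0 0) x) *
        (Matrix.of fun i j : Fin n => (Q j).coeff i) := by
    ext i j
    simp only [Matrix.mul_apply, Matrix.of_apply, Matrix.transpose_apply]
    rw [applyEuler_eq_sum (n := n) _ _ (by rw [hPd p i]; exact i.2) (by rw [hPd q j]; exact j.2),
      Finset.sum_comm]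
    exact Finset.sum_congr rfl fun l _ => by rw [Finset.sum_mul]
  have hdet := congrArg Matrix.det hmat
  rw [Matrix.det_mul, Matrix.det_mul, Matrix.det_transpose, hdetP, hdetQ, one_mul, mul_one] at hdet
  rw [hankelDet, ← hdet]
  have h1 : (Matrix.of fun i j : Fin n => applyEuler (f 0 0) x (P i * Q j)) =
      Matrix.of fun i j : Fin n => (∏ s ∈ Finset.range (i : ℕ), c s) *
        (Matrix.of fun i j : Fin n => (∏ s ∈ Finset.range (j : ℕ), e s) *
          (Matrix.of fun i j : Fin n => f i j x) i j) i j := by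
    ext i j
    exact hPQ i j
  rw [h1]
  refine (Matrix.det_mul_column (fun i : Fin n => ∏ s ∈ Finset.range (i : ℕ), c s) _).trans ?_
  have h2 := Matrix.det_mul_row (fun j : Fin n => ∏ s ∈ Finset.range (j : ℕ), e s)
    (Matrix.of fun i j : Fin n => f i j x)
  rw [h2, Fin.prod_univ_eq_prod_range (fun i => ∏ s ∈ Finset.range i, c s),
    Fin.prod_univ_eq_prod_range (fun i => ∏ s ∈ Finset.range i, e s), mul_assoc]

end Hankel

/-! ### Triangular substitutions and Toeplitz duality -/

section Determinants

open Matrix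

/-- The columns run over the monomials of degree `n - 1` in `A`, `B`. The substitution `A ↦ c A + e
B` acts on them by an upper triangular matrix with diagonal `c ^ j`, by the binomial theorem. -/
lemma det_pow_mul_pow_left {K R : Type*} [CommRing K] [CommRing R] [Algebra K R] {n : ℕ}
    (l : Fin n → R →ₗ[K] K) (A B : R) (c e : K) :
    det (of fun i j : Fin n => l i ((c • A + e • B) ^ (j : ℕ) * B ^ (n - 1 - (j : ℕ)))) =
      c ^ (n * (n - 1) / 2) *
        det (of fun i j : Fin n => l i (A ^ (j : ℕ) * B ^ (n - 1 - (j : ℕ)))) := by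
  let V : Matrix (Fin n) (Fin n) K := of fun k j => 
    c ^ (k : ℕ) * e ^ ((j : ℕ) - k) * ((j : ℕ).choose k : K)
  have hV : V.det = c ^ (n * (n - 1) / 2) := by
    rw [Matrix.det_of_isUpperTriangular]
    · simp only [V, of_apply, Nat.sub_self, pow_zero, mul_one, Nat.choose_self, Nat.cast_one]
      rw [Finset.prod_pow_eq_pow_sum, Fin.sum_univ_eq_sum_range (fun i => i) n,
        Finset.sum_range_id]
    · intro i j hij
      simp only [V, of_apply]
      rw [Nat.choose_eq_zero_of_lt (by simpa using hij)]
      simp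
  have hM : (of fun i j : Fin n => l i ((c • A + e • B) ^ (j : ℕ) * B ^ (n - 1 - (j : ℕ)))) =
      (of fun i j : Fin n => l i (A ^ (j : ℕ) * B ^ (n - 1 - (j : ℕ)))) * V := by
    ext i j
    rw [mul_apply]
    simp only [V, of_apply]
    rw [Fin.sum_univ_eq_sum_range (fun k => l i (A ^ k * B ^ (n - 1 - k)) *
      (c ^ k * e ^ ((j : ℕ) - k) * ((j : ℕ).choose k : K))) n]
    rw [← Finset.sum_subset (Finset.range_subset_range.2 (Nat.succ_le_of_lt j.2))]
    · rw [add_pow, Finset.sum_mul, map_sum]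
      refine Finset.sum_congr rfl fun k hk => ?_
      have hk' : k ≤ (j : ℕ) := Nat.lt_succ_iff.1 (Finset.mem_range.1 hk)
      have : (c • A) ^ k * (e • B) ^ ((j : ℕ) - k) * ((j : ℕ).choose k : R) *
          B ^ (n - 1 - (j : ℕ)) = (c ^ k * e ^ ((j : ℕ) - k) * ((j : ℕ).choose k : K)) •
            (A ^ k * B ^ (n - 1 - k)) := by
        rw [smul_pow, smul_pow, show n - 1 - k = ((j : ℕ) - k) + (n - 1 - j) by omega, pow_add,
          Algebra.smul_def, Algebra.smul_def, Algebra.smul_def]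
        simp only [map_mul, map_pow, map_natCast]
        ring
      rw [this, map_smul, smul_eq_mul, mul_comm]
    · intro k _ hk
      rw [Nat.choose_eq_zero_of_lt (by simpa using hk)]
      simp
  rw [hM, det_mul, hV, mul_comm]

/-- The roles of `A` and `B` are exchanged by reversing the order of both rows and columns, which
leaves the determinant alone. -/
lemma det_pow_mul_pow_right {K R : Type*} [CommRing K] [CommRing R] [Algebra K R] {n : ℕ}
    (l : Fin n → R →ₗ[K] K) (A B : R) (c e : K) :
    det (of fun i j : Fin n => l i (A ^ (j : ℕ) * (c • B + e • A) ^ (n - 1 - (j : ℕ)))) =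
      c ^ (n * (n - 1) / 2) *
        det (of fun i j : Fin n => l i (A ^ (j : ℕ) * B ^ (n - 1 - (j : ℕ)))) := by
  have h := det_pow_mul_pow_left (fun i => l (Fin.rev i)) B A c e
  rw [← det_submatrix_equiv_self Fin.revPerm, ← det_submatrix_equiv_self Fin.revPerm
    (of fun i j : Fin n => l i (A ^ (j : ℕ) * B ^ (n - 1 - (j : ℕ))))]
  convert h using 3
  · ext i j
    simp only [submatrix_apply, of_apply, Fin.revPerm_apply, Fin.val_rev]
    rw [mul_comm, show n - 1 - (n - (j + 1 : ℕ)) = j by omega,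
      show n - (j + 1 : ℕ) = n - 1 - j by omega]
  · ext i j
    simp only [submatrix_apply, of_apply, Fin.revPerm_apply, Fin.val_rev]
    rw [mul_comm, show n - 1 - (n - (j + 1 : ℕ)) = j by omega,
      show n - (j + 1 : ℕ) = n - 1 - j by omega]

/-- A matrix whose first `a` columns are those of the identity has the determinant of its last
block. -/
lemma det_of_first_columns_one {K : Type*} [CommRing K] {l a b : ℕ} (h : l = a + b)
    (F : ℕ → ℕ → K) :
    det (of fun r c : Fin l => if (c : ℕ) < a then (if (r : ℕ) = c then 1 else 0)
      else F r (c - a)) = det (of fun i j : Fin b => F (a + i) j) := by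
  subst h
  rw [← det_submatrix_equiv_self finSumFinEquiv]
  have : (of fun r c : Fin (a + b) => if (c : ℕ) < a then (if (r : ℕ) = c then (1 : K) else 0)
      else F r (c - a)).submatrix finSumFinEquiv finSumFinEquiv =
      fromBlocks 1 (of fun (i : Fin a) (j : Fin b) => F i j) 0
        (of fun i j : Fin b => F (a + i) j) := by
    ext i j
    rcases i with i | i <;> rcases j with j | j
    · simp [one_apply, Fin.ext_iff]
    · simp
    · have : a + (i : ℕ) ≠ j := by omega
      simp [this]
    · simp
  rw [this, det_fromBlocks_zero₂₁, det_one, one_mul]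

lemma val_finRotate_pow (n k : ℕ) (i : Fin (n + 1)) :
    (((finRotate (n + 1)) ^ k) i : ℕ) = (i + k) % (n + 1) := by
  induction k with
  | zero => simp [Nat.mod_eq_of_lt i.2]
  | succ k ih =>
    rw [pow_succ', Equiv.Perm.mul_apply, finRotate_apply, Fin.val_add, ih, Fin.val_one',
      Nat.add_mod_mod, Nat.mod_add_mod, add_assoc]

open PowerSeries in
/-- Minors of the Toeplitz matrix of a power series and complementary minors of the Toeplitz matrix
of its inverse. -/
theorem det_toeplitz_eq_det_toeplitz_inv {K : Type*} [CommRing K] (h e : K⟦X⟧) (he : h * e = 1)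
    (h0 : constantCoeff h = 1) (N d : ℕ) :
    det (of fun i j : Fin N => coeff (d + i) (X ^ (j : ℕ) * h)) =
      (-1) ^ (N * d) * det (of fun i j : Fin d => coeff (N + i) (X ^ (j : ℕ) * e)) := by
  rcases Nat.eq_zero_or_pos (N + d) with hl | hl
  · obtain rfl : N = 0 := by omega
    obtain rfl : d = 0 := by omega
    simp
  obtain ⟨l, hl⟩ := Nat.exists_eq_succ_of_ne_zero hl.ne'
  rw [Nat.succ_eq_add_one] at hl
  let H : Matrix (Fin (l + 1)) (Fin (l + 1)) K := of fun i j => coeff (i : ℕ) (X ^ (j : ℕ) * h)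
  let Y' : Matrix (Fin (l + 1)) (Fin (l + 1)) K := of fun r c =>
    if (c : ℕ) < N then (if (r : ℕ) = c then 1 else 0) else
      (fun i j => coeff i (X ^ j * e)) (r : ℕ) (c - N)
  let σ : Equiv.Perm (Fin (l + 1)) := finRotate (l + 1) ^ N
  have hH : H.det = 1 := by
    rw [Matrix.det_of_isLowerTriangular]
    · refine Finset.prod_eq_one fun i _ => ?_
      simp [H, coeff_X_pow_mul', h0]
    · intro i j hij
      have : ¬ (j : ℕ) ≤ i := by
        have : i < j := by simpa using hij
        simpa using this
      simp only [H, of_apply]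
      rw [coeff_X_pow_mul', if_neg this]
  have hY' : Y'.det = det (of fun i j : Fin d => coeff (N + i) (X ^ (j : ℕ) * e)) :=
    det_of_first_columns_one hl.symm (fun i j => coeff i (X ^ j * e))
  have hσ : (Equiv.Perm.sign σ : ℤ) = (-1) ^ (N * d) := by
    rw [map_pow, sign_finRotate, ← pow_mul]
    push_cast
    rcases N.eq_zero_or_pos with rfl | hN
    · simp
    -- The sign of the rotation is `(-1) ^ (l * N)` with `l = N + d - 1`, and `(N - 1) * N` is even.
    · have : l * N = N * d + (N - 1) * N := by
        obtain ⟨N, rfl⟩ := Nat.exists_eq_succ_of_ne_zero hN.ne'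
        obtain rfl : l = N + d := by omega
        simp
        ring
      rw [this, pow_add, (show Even ((N - 1) * N) by rw [mul_comm]; exact Nat.even_mul_pred_self N).neg_one_pow, mul_one]
  -- After rotation the first `d` columns of `Y'` are Toeplitz columns of `e`, which `H` turns into
  -- unit vectors because `h * e = 1`; the last `N` are unit vectors, which select the first `N`
  -- columns of `H`. As `det H = 1`, comparing determinants of both sides gives the duality.
  have hmul : H * Y'.submatrix id σ = of fun r c : Fin (l + 1) =>
      if (c : ℕ) < d then (if (r : ℕ) = c then 1 else 0) else
        (fun i j => coeff i (X ^ j * h)) (r : ℕ) (c - d) := by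
    ext r c
    rw [mul_apply]
    simp only [submatrix_apply, id, of_apply, Y', H, σ]
    by_cases hc : (c : ℕ) < d
    · have hcN : (((finRotate (l + 1)) ^ N) c : ℕ) = c + N := by
        rw [val_finRotate_pow, Nat.mod_eq_of_lt (by omega)]
      simp only [hcN, if_pos hc, if_neg (show ¬ ((c : ℕ) + N < N) by omega), Nat.add_sub_cancel]
      rw [Fin.sum_univ_eq_sum_range
        (fun k => coeff (r : ℕ) (X ^ k * h) * coeff k (X ^ (c : ℕ) * e)) (l + 1),
        ← Finset.sum_subset (Finset.range_subset_range.2 (Nat.succ_le_of_lt r.2))]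
      · have h1 : coeff (r : ℕ) ((X ^ (c : ℕ) * e) * h) = if (r : ℕ) = c then 1 else 0 := by
          rw [mul_assoc, mul_comm e, he, mul_one, coeff_X_pow]
        rw [← h1, coeff_mul, Finset.Nat.sum_antidiagonal_eq_sum_range_succ_mk]
        refine Finset.sum_congr rfl fun k hk => ?_
        have hk' : k ≤ (r : ℕ) := Nat.lt_succ_iff.1 (Finset.mem_range.1 hk)
        rw [coeff_X_pow_mul' h, if_pos hk', mul_comm]
      · intro k _ hk
        rw [coeff_X_pow_mul' h, if_neg (by simpa using hk), zero_mul]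
    · have hcN : (((finRotate (l + 1)) ^ N) c : ℕ) = c - d := by
        have := c.2
        rw [val_finRotate_pow, show (c : ℕ) + N = (c - d) + (l + 1) by omega, Nat.add_mod_right,
          Nat.mod_eq_of_lt (by omega)]
      have hlt : (c : ℕ) - d < N := by have := c.2; omega
      simp only [hcN, if_neg hc, if_pos hlt]
      rw [Finset.sum_eq_single (⟨c - d, by omega⟩ : Fin (l + 1))]
      · simp
      · intro k _ hk
        rw [if_neg, mul_zero]
        intro hk'
        exact hk (Fin.ext hk')
      · simp
  have hdet := congrArg det hmul
  rw [det_mul, hH, one_mul, det_permute', hY',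
    det_of_first_columns_one (show l + 1 = d + N by omega) (fun i j => coeff i (X ^ j * h))] at hdet
  rw [← hdet]
  congr 1
  have := congrArg (Int.cast : ℤ → K) hσ
  push_cast at this ⊢
  exact this

end Determinants

/-! ### Row-to-row transfer on exterior products -/

section Transfer

/-- Deleting the last entry of a row state. -/
def rowInit {n : ℕ} (s : Fin (n + 1) → Bool) : Fin n → Bool := fun i => s i.castSucc

/-- The number of lines in a row state. -/
def lineCount : {n : ℕ} → (Fin n → Bool) → ℕ
  | 0, _ => 0
  | n + 1, s => lineCount (rowInit s) + (s (Fin.last n)).toNat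

/-- The weight of a prefix of a row of the lattice, between the states `t` (top) and `s` (bottom)
of the vertical edges, with the rightmost horizontal edge empty and the last horizontal edge in
state `r`. -/
noncomputable def prefixWeight (w : Bool → Bool → Bool → Bool → ℂ) :
    {n : ℕ} → (Fin n → Bool) → (Fin n → Bool) → Bool → ℂ
  | 0, _, _, r => if r = false then 1 else 0
  | n + 1, t, s, r => ∑ r' : Bool, prefixWeight w (rowInit t) (rowInit s) r' *
      w r (s (Fin.last n)) (t (Fin.last n)) r'

lemma sum_fun_succ {A : Type*} [AddCommMonoid A] {S : Type*} [Fintype S] {n : ℕ}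
    (F : (Fin (n + 1) → S) → A) :
    ∑ h, F h = ∑ r : S, ∑ h : Fin n → S, F (Fin.snoc (α := fun _ => S) h r) := by
  rw [← Fintype.sum_prod_type']
  exact (Fintype.sum_equiv (Fin.snocEquiv fun _ => S) _ _ fun _ => rfl).symm

@[simp] lemma rowInit_snoc {n : ℕ} (s : Fin n → Bool) (b : Bool) :
    rowInit (Fin.snoc (α := fun _ => Bool) s b) = s := by
  ext i
  simp [rowInit]

lemma sum_horizontal_eq_prefixWeight (w : Bool → Bool → Bool → Bool → ℂ) {n : ℕ}
    (t s : Fin n → Bool) (r : Bool) :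
    (∑ h : Fin (n + 1) → Bool, if h 0 = false ∧ h (Fin.last n) = r then
      ∏ j : Fin n, w (h j.succ) (s j) (t j) (h j.castSucc) else 0) = prefixWeight w t s r := by
  induction n generalizing r with
  | zero =>
    rw [Fintype.sum_equiv (Equiv.funUnique (Fin 1) Bool) _
      (fun b => if b = false ∧ b = r then (1 : ℂ) else 0)]
    · cases r <;> simp [prefixWeight]
    · intro h
      simp [Equiv.funUnique]
  | succ n ih =>
    rw [sum_fun_succ, Finset.sum_eq_single r, prefixWeight]
    · rw [Finset.sum_congr rfl fun r' _ => congrArg (· * _) (ih (rowInit t) (rowInit s) r').symm]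
      simp only [Finset.sum_mul]
      rw [Finset.sum_comm]
      refine Finset.sum_congr rfl fun h _ => ?_
      rw [Finset.sum_eq_single (h (Fin.last n))]
      · have h0 : (Fin.snoc (α := fun _ => Bool) h r : Fin (n + 2) → Bool) 0 = h 0 := by
          rw [← Fin.castSucc_zero, Fin.snoc_castSucc]
        rw [h0, Fin.snoc_last, Fin.prod_univ_castSucc, Fin.succ_last, Fin.snoc_last,
          Fin.snoc_castSucc]
        simp only [and_true, ite_mul, zero_mul]
        congr 1
        congr 1
        refine Finset.prod_congr rfl fun j _ => ?_
        rw [Fin.succ_castSucc, Fin.snoc_castSucc, Fin.snoc_castSucc]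
        rfl
      · intro b _ hb
        rw [if_neg (fun h' => hb h'.2.symm), zero_mul]
      · simp
    · intro b _ hb
      refine Finset.sum_eq_zero fun h _ => if_neg fun h' => hb ?_
      simpa using h'.2
    · simp

/-- Every vertex of non-zero weight conserves lines: those entering from the top and right leave
through the bottom and left. -/
lemma lineCount_eq_of_prefixWeight_ne_zero {α Δ u : ℂ} {n : ℕ} {t s : Fin n → Bool} {r : Bool}
    (h : prefixWeight (vertexWeight α Δ u) t s r ≠ 0) :
    lineCount t = lineCount s + r.toNat := by
  induction n generalizing r with
  | zero =>
    cases r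
    · rfl
    · simp [prefixWeight] at h
  | succ n ih =>
    rw [prefixWeight] at h
    obtain ⟨r', _, hr⟩ := Finset.exists_ne_zero_of_sum_ne_zero h
    have h1 := ih (left_ne_zero_of_mul hr)
    have h2 := right_ne_zero_of_mul hr
    simp only [lineCount, h1]
    generalize s (Fin.last n) = a at *
    generalize t (Fin.last n) = b at *
    cases a <;> cases b <;> cases r <;> cases r' <;> simp [vertexWeight] at h2 ⊢

variable {V : Type*} [AddCommGroup V] [Module ℂ V]

/-- The exterior product of the vectors `v i x`, where `x` is the position of the `i`-th line. -/
noncomputable def wedgeState (v : ℕ → ℕ → V) : {n : ℕ} → (Fin n → Bool) → ExteriorAlgebra ℂ V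
  | 0, _ => 1
  | n + 1, s => if s (Fin.last n) then
      wedgeState v (rowInit s) * ExteriorAlgebra.ι ℂ (v (lineCount (rowInit s)) n)
    else wedgeState v (rowInit s)

/-- The row-to-row transfer, applied to exterior products. -/
theorem sum_prefixWeight_smul_wedgeState {α Δ u w₁ : ℂ} (hw₁ : w₁ = α / Δ * (u - 1 / u))
    (v v' Q : ℕ → ℕ → V) (c : ℕ → ℂ) (hQ0 : ∀ i, Q i 0 = 0)
    (hQ : ∀ i n, Q i (n + 1) = w₁ ^ n • v i n + (α * u) • Q i n)
    (hv' : ∀ i n, w₁ ^ (n + 1) • v' i n = (u / α * w₁ ^ n) • v i n + Q i n)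
    (hQv : ∀ i n, Q (i + 1) (n + 1) = c n • v' i n) {n : ℕ} (s : Fin n → Bool) (r : Bool) :
    ∑ t : Fin n → Bool, prefixWeight (vertexWeight α Δ u) t s r • wedgeState v t =
      if r then wedgeState v' s * ExteriorAlgebra.ι ℂ (Q (lineCount s) n)
      else w₁ ^ n • wedgeState v' s := by
  induction n generalizing r with
  | zero => cases r <;> simp [prefixWeight, wedgeState, hQ0]
  | succ n ih =>
    have key : ∀ b : Bool, ∑ t : Fin n → Bool,
        prefixWeight (vertexWeight α Δ u) (Fin.snoc (α := fun _ => Bool) t b) s r •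
          wedgeState v (Fin.snoc (α := fun _ => Bool) t b) =
        ∑ r' : Bool, vertexWeight α Δ u r (s (Fin.last n)) b r' •
          ((if r' then wedgeState v' (rowInit s) * ExteriorAlgebra.ι ℂ (Q (lineCount (rowInit s)) n)
            else w₁ ^ n • wedgeState v' (rowInit s)) *
          (if b then ExteriorAlgebra.ι ℂ (v (lineCount (rowInit s) + r'.toNat) n) else 1)) := by
      intro b
      simp only [prefixWeight, rowInit_snoc, Fin.snoc_last, Finset.sum_smul]
      rw [Finset.sum_comm]
      refine Finset.sum_congr rfl fun r' _ => ?_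
      rw [← ih, Finset.sum_mul, Finset.smul_sum]
      refine Finset.sum_congr rfl fun t _ => ?_
      -- The index of the vector of the last line is the number of lines of `t`; conservation
      -- expresses it through `s` and `r'`, so it can be taken out of the sum.
      by_cases h : prefixWeight (vertexWeight α Δ u) t (rowInit s) r' = 0
      · simp [h]
      · rw [← lineCount_eq_of_prefixWeight_ne_zero h, mul_comm, mul_smul, smul_mul_assoc]
        congr 2
        cases b <;> simp [wedgeState]
    rw [sum_fun_succ, Fintype.sum_bool, key, key, Fintype.sum_bool, Fintype.sum_bool]
    simp only [wedgeState, lineCount]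
    set P := wedgeState v' (rowInit s)
    set m := lineCount (rowInit s)
    generalize s (Fin.last n) = a
    -- With the bottom edge occupied and the left one empty, the two possible vertices give `hv'`;
    -- with only the left one occupied they give `hQ`. If both are occupied no vertex is allowed,
    -- and the right side vanishes because `hQv` makes the last two factors of the product
    -- proportional.
    cases a <;> cases r
    · simp [vertexWeight, hw₁, pow_succ', mul_smul]
    · simp [vertexWeight, hQ, mul_add]
    · simp [vertexWeight]
      rw [← mul_smul_comm, ← mul_smul_comm, ← mul_smul_comm, ← map_smul, ← map_smul,
        ← map_smul, smul_smul, hv', map_add, mul_add]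
    · simp [vertexWeight, hQv, mul_assoc]

/-- A row state with `N` consecutive lines, starting at position `c`. -/
lemma wedgeState_consecutive (v : ℕ → ℕ → V) (c N : ℕ) {n : ℕ} {s : Fin n → Bool}
    (hs : ∀ j : Fin n, s j = true ↔ c ≤ (j : ℕ) ∧ (j : ℕ) < c + N) :
    wedgeState v s =
        ((List.range (min (n - c) N)).map fun i => ExteriorAlgebra.ι ℂ (v i (c + i))).prod ∧
      lineCount s = min (n - c) N := by
  induction n with
  | zero => simp [wedgeState, lineCount]
  | succ n ih =>
    obtain ⟨h1, h2⟩ := ih (s := rowInit s) (fun j => by simpa [rowInit] using hs j.castSucc)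
    have h3 := hs (Fin.last n)
    rw [Fin.val_last] at h3
    simp only [wedgeState, lineCount, h1, h2]
    by_cases hc : c ≤ n ∧ n < c + N
    · rw [if_pos (h3.2 hc), h3.2 hc, show min (n + 1 - c) N = (n - c) + 1 by omega,
        show min (n - c) N = n - c by omega, List.range_succ]
      simp [Nat.add_sub_cancel' hc.1]
    · have h4 : s (Fin.last n) = false := by
        rw [← Bool.not_eq_true, h3]; exact hc
      have h5 : min (n + 1 - c) N = min (n - c) N := by omega
      simp [h4, h5]

/-- If the last of `N` lines is annihilated beyond position `N - 1`, only the state with the lines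
in the first `N` positions has a non-zero exterior product. -/
lemma wedgeState_eq_zero_or (v : ℕ → ℕ → V) {N : ℕ} (hv : ∀ n, N ≤ n → v (N - 1) n = 0) {n : ℕ}
    (s : Fin n → Bool) :
    lineCount s ≤ n ∧ (lineCount s = n → ∀ j, s j = true) ∧
      (lineCount s = N → wedgeState v s = 0 ∨ ∀ j : Fin n, s j = true ↔ (j : ℕ) < N) := by
  induction n with
  | zero => exact ⟨le_rfl, fun _ j => j.elim0, fun _ => Or.inr fun j => j.elim0⟩
  | succ n ih =>
    obtain ⟨h1, h2, h3⟩ := ih (rowInit s)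
    simp only [lineCount, wedgeState]
    cases hs : s (Fin.last n) with
    | false =>
      refine ⟨by simp; omega, fun h => by simp at h; omega, fun h => ?_⟩
      simp only [Bool.toNat_false, add_zero] at h
      rcases h3 h with h4 | h4
      · left; simpa using h4
      · right
        intro j
        induction j using Fin.lastCases with
        | last => simp [hs]; omega
        | cast j => exact h4 j
    | true =>
      refine ⟨by simpa using h1, fun h => ?_, fun h => ?_⟩
      · simp only [Bool.toNat_true, Nat.add_right_cancel_iff] at h
        intro j
        induction j using Fin.lastCases with
        | last => exact hs
        | cast j => exact h2 h j
      · simp only [Bool.toNat_true] at h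
        rcases Nat.lt_or_ge n N with h4 | h4
        · right
          have h5 : lineCount (rowInit s) = n := by omega
          intro j
          induction j using Fin.lastCases with
          | last => simp [hs, h4]
          | cast j =>
            refine ⟨fun _ => ?_, fun _ => h2 h5 j⟩
            rw [Fin.val_castSucc]
            omega
        -- Here the line of index `N - 1` sits at a position `n ≥ N`, where its vector is zero.
        · left
          rw [if_pos rfl, show lineCount (rowInit s) = N - 1 by omega, hv n h4, map_zero, mul_zero]

/-- The linear functional on the exterior algebra which is the determinant on products of `N`
vectors and vanishes on the products of any other number of vectors. -/
noncomputable def wedgeDet (N : ℕ) : ExteriorAlgebra ℂ (Fin N → ℂ) →ₗ[ℂ] ℂ :=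
  ExteriorAlgebra.liftAlternating fun i =>
    if h : i = N then (Matrix.detRowAlternating (R := ℂ) (n := Fin N)).domDomCongr (finCongr h.symm)
    else 0

lemma list_range_map_prod_eq_ιMulti (w : ℕ → V) (n : ℕ) :
    ((List.range n).map fun i => ExteriorAlgebra.ι ℂ (w i)).prod =
      ExteriorAlgebra.ιMulti ℂ n fun i : Fin n => w i := by
  rw [ExteriorAlgebra.ιMulti_apply]
  congr 1
  apply List.ext_getElem <;> simp

lemma wedgeDet_prod (N : ℕ) (w : ℕ → Fin N → ℂ) :
    wedgeDet N ((List.range N).map fun i => ExteriorAlgebra.ι ℂ (w i)).prod =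
      Matrix.det (Matrix.of fun i j : Fin N => w i j) := by
  rw [list_range_map_prod_eq_ιMulti, wedgeDet, ExteriorAlgebra.liftAlternating_apply_ιMulti,
    dif_pos rfl]
  rfl

/-- Only homogeneity of degree `lineCount s` matters here: `wedgeDet` then kills every state whose
number of lines is not `N`. -/
lemma wedgeState_eq_ιMulti (v : ℕ → ℕ → V) {n : ℕ} (s : Fin n → Bool) :
    ∃ w : ℕ → V, wedgeState v s = ExteriorAlgebra.ιMulti ℂ (lineCount s) fun i => w i := by
  simp only [← list_range_map_prod_eq_ιMulti]
  induction n with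
  | zero => exact ⟨0, by simp [wedgeState, lineCount]⟩
  | succ n ih =>
    obtain ⟨w, hw⟩ := ih (rowInit s)
    simp only [wedgeState, lineCount, hw]
    cases s (Fin.last n) with
    | false => exact ⟨w, by simp⟩
    | true =>
      refine ⟨fun i => if i < lineCount (rowInit s) then w i else v (lineCount (rowInit s)) n, ?_⟩
      simp only [if_true, Bool.toNat_true, List.range_succ, List.map_append, List.prod_append,
        List.map_cons, List.map_nil, List.prod_singleton, lt_irrefl, if_false]
      congr 2
      refine List.map_congr_left fun i hi => ?_
      rw [if_pos (List.mem_range.1 hi)]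

lemma wedgeDet_wedgeState_of_ne {N : ℕ} (v : ℕ → ℕ → Fin N → ℂ) {n : ℕ} {s : Fin n → Bool}
    (h : lineCount s ≠ N) : wedgeDet N (wedgeState v s) = 0 := by
  obtain ⟨w, hw⟩ := wedgeState_eq_ιMulti v s
  rw [hw, wedgeDet, ExteriorAlgebra.liftAlternating_apply_ιMulti, dif_neg h]
  rfl

/-- A sum over paths of a product of transfer weights, computed step by step. -/
lemma sum_paths_eq {S : Type*} [Fintype S] [DecidableEq S] (T : S → S → ℂ) (ρ : ℕ → S → ℂ) (c : ℂ)
    (s₀ : S) (h0 : ∀ s, ρ 0 s = if s = s₀ then 1 else 0)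
    (hT : ∀ k s, ∑ t, T t s * ρ k t = c * ρ (k + 1) s) (k : ℕ) (s : S) :
    (∑ P : Fin (k + 1) → S, if P 0 = s₀ ∧ P (Fin.last k) = s then
      ∏ i : Fin k, T (P i.castSucc) (P i.succ) else 0) = c ^ k * ρ k s := by
  induction k generalizing s with
  | zero =>
    rw [Fintype.sum_equiv (Equiv.funUnique (Fin 1) S) _
      (fun b => if b = s₀ ∧ b = s then (1 : ℂ) else 0) fun P => by simp [Equiv.funUnique]]
    rw [h0, Finset.sum_eq_single s]
    · simp
    · intro b _ hb
      rw [if_neg fun h => hb h.2]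
    · simp
  | succ k ih =>
    rw [sum_fun_succ, Finset.sum_eq_single s]
    · rw [pow_succ, mul_assoc, ← hT, Finset.mul_sum]
      have : ∀ t, c ^ k * (T t s * ρ k t) = (∑ P : Fin (k + 1) → S,
          if P 0 = s₀ ∧ P (Fin.last k) = t then
            ∏ i : Fin k, T (P i.castSucc) (P i.succ) else 0) * T t s := by
        intro t
        rw [ih]
        ring
      simp only [this, Finset.sum_mul]
      rw [Finset.sum_comm]
      refine Finset.sum_congr rfl fun P _ => ?_
      rw [Finset.sum_eq_single (P (Fin.last k))]
      · have hP0 : (Fin.snoc (α := fun _ => S) P s : Fin (k + 2) → S) 0 = P 0 := by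
          rw [← Fin.castSucc_zero, Fin.snoc_castSucc]
        rw [hP0, Fin.snoc_last, Fin.prod_univ_castSucc, Fin.succ_last, Fin.snoc_last,
          Fin.snoc_castSucc]
        simp only [and_true, ite_mul, zero_mul]
        congr 1
        congr 1
        refine Finset.prod_congr rfl fun j _ => ?_
        rw [Fin.succ_castSucc, Fin.snoc_castSucc, Fin.snoc_castSucc]
      · intro b _ hb
        rw [if_neg (fun h' => hb h'.2.symm), zero_mul]
      · simp
    · intro b _ hb
      refine Finset.sum_eq_zero fun P _ => if_neg fun h' => hb ?_
      simpa using h'.2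
    · simp

/-- A configuration as a sequence of states of vertical edges together with the states of the
horizontal edges. -/
def configEquivRows (L M : ℕ) :
    Config L M ≃ (Fin (M + 1) → Fin L → Bool) × (Fin M → Fin (L + 1) → Bool) where
  toFun C := (fun k j => C.vert j k, C.horiz)
  invFun p := ⟨fun j k => p.1 k j, p.2⟩
  left_inv _ := rfl
  right_inv _ := rfl

/-- The homogeneous partition function as a sum over the sequences of row states. -/
lemma homPartitionFunction_eq_sum_rows (L M N : ℕ) (α Δ u : ℂ) :
    homPartitionFunction L M N α Δ u =
      ∑ P : Fin (M + 1) → Fin L → Bool,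
        if P 0 = (fun j : Fin L => decide ((j : ℕ) < N)) ∧
            P (Fin.last M) = (fun j : Fin L => decide (L ≤ (j : ℕ) + N)) then
          ∏ k : Fin M, prefixWeight (vertexWeight α Δ u) (P k.castSucc) (P k.succ) false else 0 := by
  classical
  rw [homPartitionFunction, partitionFunction, Finset.sum_filter,
    ← Fintype.sum_equiv (configEquivRows L M).symm _ _ fun _ => rfl, Fintype.sum_prod_type]
  refine Finset.sum_congr rfl fun P _ => ?_
  simp only [← sum_horizontal_eq_prefixWeight, Finset.prod_univ_sum, Fintype.piFinset_univ,
    Finset.prod_ite_zero, Finset.mem_univ, true_imp_iff]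
  by_cases hP : P 0 = (fun j : Fin L => decide ((j : ℕ) < N)) ∧
      P (Fin.last M) = (fun j : Fin L => decide (L ≤ (j : ℕ) + N))
  · rw [if_pos hP]
    refine Finset.sum_congr rfl fun H _ => ?_
    have hb : ((configEquivRows L M).symm (P, H)).HasBoundary N ↔
        ∀ k, H k 0 = false ∧ H k (Fin.last L) = false := by
      constructor
      · exact fun h k => ⟨h.2.2.1 k, h.2.2.2 k⟩
      · refine fun h => ⟨fun j => ?_, fun j => ?_, fun k => (h k).1, fun k => (h k).2⟩
        · change P 0 j = true ↔ _
          rw [hP.1, decide_eq_true_iff]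
        · change P (Fin.last M) j = true ↔ _
          rw [hP.2, decide_eq_true_iff]
    simp only [hb]
    congr 1
    rw [Finset.prod_comm]
    refine Finset.prod_congr rfl fun k _ => Finset.prod_congr rfl fun j _ => ?_
    simp [Config.localWeight, configEquivRows]
  · rw [if_neg hP]
    refine Finset.sum_eq_zero fun H _ => if_neg fun h => hP ⟨?_, ?_⟩
    · ext j
      rw [Bool.eq_iff_iff, decide_eq_true_iff]
      exact h.1 j
    · ext j
      rw [Bool.eq_iff_iff, decide_eq_true_iff]
      exact h.2.1 j

/-- The homogeneous partition function as a determinant, in terms of vectors that satisfy the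
relations of the row-to-row transfer. -/
theorem homPartitionFunction_eq_det {L M N : ℕ} (hNL : N ≤ L) {α Δ u w₁ : ℂ}
    (hw₁ : w₁ = α / Δ * (u - 1 / u)) (v Q : ℕ → ℕ → ℕ → Fin N → ℂ) (c : ℕ → ℂ)
    (hQ0 : ∀ k i, Q k i 0 = 0)
    (hQ : ∀ k i n, Q k i (n + 1) = w₁ ^ n • v k i n + (α * u) • Q k i n)
    (hv : ∀ k i n, w₁ ^ (n + 1) • v (k + 1) i n = (u / α * w₁ ^ n) • v k i n + Q k i n)
    (hQv : ∀ k i n, Q k (i + 1) (n + 1) = c n • v (k + 1) i n)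
    (hlast : ∀ n, N ≤ n → v 0 (N - 1) n = 0)
    (hone : Matrix.det (Matrix.of fun i j : Fin N => v 0 i i j) = 1) :
    homPartitionFunction L M N α Δ u =
      (w₁ ^ L) ^ M * Matrix.det (Matrix.of fun i j : Fin N => v M i (L - N + i) j) := by
  -- The amplitude of a row state after `k` rows, up to the factor `(w₁ ^ L) ^ k`, is the
  -- determinant of its exterior product. This holds for all states at once, so the boundary
  -- conditions enter only at `k = 0` and at the end.
  rw [homPartitionFunction_eq_sum_rows,
    sum_paths_eq (fun t s => prefixWeight (vertexWeight α Δ u) t s false)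
      (fun k s => wedgeDet N (wedgeState (v k) s)) (w₁ ^ L)]
  · congr 1
    have h := (wedgeState_consecutive (v M) (L - N) N (n := L)
      (s := fun j => decide (L ≤ (j : ℕ) + N)) fun j => by
        have := j.2
        rw [decide_eq_true_iff]; omega).1
    rw [h, show min (L - (L - N)) N = N by omega, wedgeDet_prod N fun i => v M i (L - N + i)]
  · intro s
    have htop := wedgeState_consecutive (v 0) 0 N (n := L)
      (s := fun j => decide ((j : ℕ) < N)) fun j => by simp
    rw [show min (L - 0) N = N by omega] at htop
    split_ifs with hs
    · rw [hs, htop.1, wedgeDet_prod N fun i => v 0 i (0 + i)]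
      simpa using hone
    · by_cases hc : lineCount s = N
      · rcases (wedgeState_eq_zero_or (v 0) hlast s).2.2 hc with h | h
        · rw [h, map_zero]
        · refine absurd ?_ hs
          ext j
          rw [Bool.eq_iff_iff, decide_eq_true_iff]
          exact h j
      · exact wedgeDet_wedgeState_of_ne _ hc
  · intro k s
    have h := congrArg (wedgeDet N) (sum_prefixWeight_smul_wedgeState hw₁ (v k) (v (k + 1)) (Q k) c
      (hQ0 k) (hQ k) (hv k) (hQv k) s false)
    simpa [map_sum] using h

end Transfer

/-! ### Power series solving the transfer relations -/

section TransferVectors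

open PowerSeries

lemma coeff_one_add_C_mul_X_pow_of_lt (e : ℂ) {m k : ℕ} (h : m < k) :
    coeff k ((1 + C e * X : ℂ⟦X⟧) ^ m) = 0 := by
  induction m generalizing k with
  | zero => rw [pow_zero, coeff_one, if_neg (by omega)]
  | succ m ih =>
    obtain ⟨k, rfl⟩ := Nat.exists_eq_succ_of_ne_zero (show k ≠ 0 by omega)
    rw [pow_succ, mul_add, mul_one, ← mul_assoc, map_add, ih (by omega), Nat.succ_eq_add_one,
      coeff_succ_mul_X, mul_comm, coeff_C_mul, ih (by omega)]
    simp

lemma constantCoeff_zpow_of_eq_one {U : ℂ⟦X⟧ˣ} (h : constantCoeff (U : ℂ⟦X⟧) = 1) (z : ℤ) :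
    constantCoeff ((U ^ z : ℂ⟦X⟧ˣ) : ℂ⟦X⟧) = 1 := by
  have h1 : Units.map (constantCoeff (R := ℂ) : ℂ⟦X⟧ →* ℂ) U = 1 := Units.ext h
  have h2 := map_zpow (Units.map (constantCoeff (R := ℂ) : ℂ⟦X⟧ →* ℂ)) U z
  rw [h1, one_zpow] at h2
  exact congrArg Units.val h2

/-- The generating series of the transfer vectors. -/
noncomputable def transferSeries (N : ℕ) (E φ ψ : ℂ⟦X⟧ˣ) (k i n : ℤ) : ℂ⟦X⟧ˣ :=
  E ^ (n - i - 1) * φ ^ k * ψ ^ (i + 1 - N)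

/-- The first relation between `E`, `φ`, `ψ`, multiplied by a common unit. It becomes the recursion
along the row for the vector of the horizontal line. -/
lemma transferSeries_raise (N : ℕ) {E φ ψ : ℂ⟦X⟧ˣ} {x : ℂ}
    (h : (φ : ℂ⟦X⟧) * ((E : ℂ⟦X⟧) - C x * X) = (ψ : ℂ⟦X⟧)) (k i n : ℤ) :
    (transferSeries N E φ ψ (k + 1) (i - 1) n : ℂ⟦X⟧) =
      (transferSeries N E φ ψ k i n : ℂ⟦X⟧) + C x * ((transferSeries N E φ ψ (k + 1) (i - 1) (n - 1) : ℂ⟦X⟧) * X) := by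
  have h1 : transferSeries N E φ ψ (k + 1) (i - 1) n =
      E ^ (n - i - 1) * φ ^ k * ψ ^ (i - N) * φ * E := by
    rw [transferSeries, show n - (i - 1) - 1 = n - i - 1 + 1 by ring, zpow_add_one, zpow_add_one,
      show i - 1 + 1 - (N : ℤ) = i - N by ring]
    simp only [mul_comm, mul_left_comm, mul_assoc]
  have h2 : transferSeries N E φ ψ k i n = E ^ (n - i - 1) * φ ^ k * ψ ^ (i - N) * ψ := by
    rw [transferSeries, show i + 1 - (N : ℤ) = i - N + 1 by ring, zpow_add_one]
    simp only [mul_assoc]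
  have h3 : transferSeries N E φ ψ (k + 1) (i - 1) (n - 1) =
      E ^ (n - i - 1) * φ ^ k * ψ ^ (i - N) * φ := by
    rw [transferSeries, show n - 1 - (i - 1) - 1 = n - i - 1 by ring, zpow_add_one,
      show i - 1 + 1 - (N : ℤ) = i - N by ring]
    simp only [mul_comm, mul_left_comm, mul_assoc]
  rw [h1, h2, h3]
  generalize E ^ (n - i - 1) * φ ^ k * ψ ^ (i - N) = U
  simp only [Units.val_mul]
  linear_combination (U : ℂ⟦X⟧) * h

/-- The second relation, multiplied by the same unit. It becomes the update of the vertical lines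
from one row to the next. -/
lemma transferSeries_step (N : ℕ) {E φ ψ : ℂ⟦X⟧ˣ}
    (h : (ψ : ℂ⟦X⟧) * ((φ : ℂ⟦X⟧) - 1) = X * (φ : ℂ⟦X⟧)) (k i n : ℤ) :
    (transferSeries N E φ ψ (k + 1) i n : ℂ⟦X⟧) =
      (transferSeries N E φ ψ k i n : ℂ⟦X⟧) + (transferSeries N E φ ψ (k + 1) (i - 1) (n - 1) : ℂ⟦X⟧) * X := by
  have h1 : transferSeries N E φ ψ (k + 1) i n =
      E ^ (n - i - 1) * φ ^ k * ψ ^ (i - N) * φ * ψ := by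
    rw [transferSeries, zpow_add_one, show i + 1 - (N : ℤ) = i - N + 1 by ring, zpow_add_one]
    simp only [mul_comm, mul_left_comm, mul_assoc]
  have h2 : transferSeries N E φ ψ k i n = E ^ (n - i - 1) * φ ^ k * ψ ^ (i - N) * ψ := by
    rw [transferSeries, show i + 1 - (N : ℤ) = i - N + 1 by ring, zpow_add_one]
    simp only [mul_assoc]
  have h3 : transferSeries N E φ ψ (k + 1) (i - 1) (n - 1) =
      E ^ (n - i - 1) * φ ^ k * ψ ^ (i - N) * φ := by
    rw [transferSeries, show n - 1 - (i - 1) - 1 = n - i - 1 by ring, zpow_add_one,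
      show i - 1 + 1 - (N : ℤ) = i - N by ring]
    simp only [mul_comm, mul_left_comm, mul_assoc]
  rw [h1, h2, h3]
  generalize E ^ (n - i - 1) * φ ^ k * ψ ^ (i - N) = U
  simp only [Units.val_mul]
  linear_combination (U : ℂ⟦X⟧) * h

/-- The transfer vectors; the index `i` is allowed to be `-1`. -/
noncomputable def transferVector (N : ℕ) (E φ ψ : ℂ⟦X⟧ˣ) (a θ : ℂ) (k : ℕ) (i : ℤ) (n : ℕ) :
    Fin N → ℂ :=
  fun j => a ^ k * θ ^ n * θ⁻¹ ^ (j : ℕ) * coeff n (X ^ (j : ℕ) * (transferSeries N E φ ψ k i n : ℂ⟦X⟧))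

/-- The weights are absorbed by the scalars `a = w₃ / w₁` and `θ = (w₁ * w₃)⁻¹`, so that the series
themselves depend on the weights only through `u ^ 2`. The choice of `E`, `φ`, `ψ` stays free, so
that it can be made twice. -/
theorem homPartitionFunction_eq_det_coeff {L M N : ℕ} (hNL : N ≤ L) {α Δ u w₁ : ℂ}
    (hα : α ≠ 0) (hu : u ≠ 0) (hw₁ : w₁ = α / Δ * (u - 1 / u)) (hw₁0 : w₁ ≠ 0)
    {E φ ψ : ℂ⟦X⟧ˣ} {e : ℂ} (hE : (E : ℂ⟦X⟧) = 1 + C e * X)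
    (h1 : (φ : ℂ⟦X⟧) * ((E : ℂ⟦X⟧) - C (u ^ 2) * X) = (ψ : ℂ⟦X⟧)) (h2 : (ψ : ℂ⟦X⟧) * ((φ : ℂ⟦X⟧) - 1) = X * (φ : ℂ⟦X⟧))
    (hψ : constantCoeff (ψ : ℂ⟦X⟧) = 1) :
    homPartitionFunction L M N α Δ u =
      (w₁ ^ L) ^ M * ((u / α / w₁) ^ M) ^ N * ((w₁ * (u / α))⁻¹ ^ (L - N)) ^ N *
        Matrix.det (Matrix.of fun i j : Fin N => coeff (L - N + i : ℕ)
          (X ^ (j : ℕ) * (transferSeries N E φ ψ M (i : ℕ) (L - N + i : ℕ) : ℂ⟦X⟧))) := by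
  set w₃ := u / α with hw₃
  have hw₃0 : w₃ ≠ 0 := div_ne_zero hu hα
  set a := w₃ / w₁ with ha
  set θ := (w₁ * w₃)⁻¹ with hθ
  have hθ0 : θ ≠ 0 := inv_ne_zero (mul_ne_zero hw₁0 hw₃0)
  have hxw : w₃ * (α * u) = u ^ 2 := by rw [hw₃]; field_simp
  have haw : w₁ / w₃ * a = 1 := by rw [ha]; field_simp
  have hθx : w₁ * θ * u ^ 2 = α * u := by rw [← hxw, hθ]; field_simp
  have haw' : w₁ * a = w₃ := by rw [ha]; field_simp
  have hθw : w₁ * θ * w₃ = 1 := by rw [hθ]; field_simp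
  have hcE : constantCoeff (E : ℂ⟦X⟧) = 1 := by rw [hE]; simp
  have hshift : ∀ (n j : ℕ) (f : ℂ⟦X⟧), coeff (n + 1) (X ^ j * (f * X)) = coeff n (X ^ j * f) := by
    intro n j f
    rw [← mul_assoc, coeff_succ_mul_X]
  let v := transferVector N E φ ψ a θ
  -- A line on a horizontal edge carries, up to a scalar, the vector of the next row with index `i -
  -- 1` at the previous position; for `i = 0` this is the index `-1`. This makes the proportionality
  -- required by antisymmetry automatic.
  let Q : ℕ → ℕ → ℕ → Fin N → ℂ := fun k i n =>
    Nat.casesOn n 0 fun n => (w₁ / w₃ * w₁ ^ n) • v (k + 1) ((i : ℤ) - 1) n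
  rw [homPartitionFunction_eq_det hNL hw₁ (fun k i n => v k i n) Q (fun n => w₁ / w₃ * w₁ ^ n)
    (fun _ _ => rfl)]
  · have hdet : (Matrix.of fun i j : Fin N => v M (i : ℕ) (L - N + i) j) =
        Matrix.of fun i j : Fin N => (a ^ M * θ ^ (L - N) * θ ^ (i : ℕ)) *
          (Matrix.of fun i j : Fin N => θ⁻¹ ^ (j : ℕ) * (Matrix.of fun i j : Fin N => coeff (L - N + i : ℕ)
            (X ^ (j : ℕ) * (transferSeries N E φ ψ M (i : ℕ) (L - N + i : ℕ) : ℂ⟦X⟧))) i j) i j := by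
      ext i j
      simp only [v, transferVector, Matrix.of_apply, pow_add]
      ring
    rw [hdet]
    refine (congrArg _ (Matrix.det_mul_column _ _)).trans ?_
    refine (congrArg (fun z => _ * (_ * z)) (Matrix.det_mul_row _ _)).trans ?_
    rw [Finset.prod_mul_distrib, Finset.prod_const, Finset.card_univ, Fintype.card_fin]
    -- The powers of `θ` from the positions of the lines cancel against those built into the
    -- components.
    have hc : (∏ i : Fin N, θ ^ (i : ℕ)) * ∏ i : Fin N, θ⁻¹ ^ (i : ℕ) = 1 := by
      rw [← Finset.prod_mul_distrib]
      refine Finset.prod_eq_one fun i _ => ?_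
      rw [← mul_pow, mul_inv_cancel₀ hθ0, one_pow]
    rw [mul_pow]
    linear_combination ((w₁ ^ L) ^ M * (a ^ M) ^ N * (θ ^ (L - N)) ^ N *
        Matrix.det (Matrix.of fun i j : Fin N => coeff (L - N + i : ℕ)
          (X ^ (j : ℕ) * (transferSeries N E φ ψ M (i : ℕ) (L - N + i : ℕ) : ℂ⟦X⟧)))) * hc
  · intro k i n
    ext j
    have hs := congrArg (fun f => coeff n (X ^ (j : ℕ) * f))
      (transferSeries_raise N h1 k i n)
    simp only [mul_add, map_add, mul_left_comm _ (C (u ^ 2)), coeff_C_mul] at hs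
    cases n with
    | zero =>
      have h0 : coeff 0 (X ^ (j : ℕ) * ((transferSeries N E φ ψ ((k : ℤ) + 1) ((i : ℤ) - 1)
          (((0 : ℕ) : ℤ) - 1) : ℂ⟦X⟧) * X)) = 0 := by simp
      rw [h0, mul_zero, add_zero] at hs
      change (w₁ / w₃ * w₁ ^ 0) * v (k + 1) ((i : ℤ) - 1) 0 j = w₁ ^ 0 * v k i 0 j + α * u * 0
      simp only [v, transferVector]
      push_cast at hs ⊢
      rw [hs]
      linear_combination (a ^ k * θ⁻¹ ^ (j : ℕ) *
        coeff 0 (X ^ (j : ℕ) * (transferSeries N E φ ψ k i 0 : ℂ⟦X⟧))) * haw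
    | succ n =>
      rw [hshift] at hs
      change (w₁ / w₃ * w₁ ^ (n + 1)) * v (k + 1) ((i : ℤ) - 1) (n + 1) j =
        w₁ ^ (n + 1) * v k i (n + 1) j +
          α * u * ((w₁ / w₃ * w₁ ^ n) * v (k + 1) ((i : ℤ) - 1) n j)
      simp only [v, transferVector]
      push_cast at hs ⊢
      rw [add_sub_cancel_right] at hs
      rw [hs]
      generalize coeff (n + 1) (X ^ (j : ℕ) * (transferSeries N E φ ψ k i (n + 1) : ℂ⟦X⟧)) = A
      generalize coeff n (X ^ (j : ℕ) * (transferSeries N E φ ψ (k + 1) (i - 1) n : ℂ⟦X⟧)) = B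
      generalize θ⁻¹ ^ (j : ℕ) = t
      linear_combination (w₁ ^ (n + 1) * a ^ k * θ ^ (n + 1) * t * (A + u ^ 2 * B) -
        α * u * w₁ ^ n * a ^ k * θ ^ n * t * B) * haw + w₁ ^ n * a ^ k * θ ^ n * t * B * hθx
  · intro k i n
    ext j
    have hs := congrArg (fun f => coeff n (X ^ (j : ℕ) * f))
      (transferSeries_step N (E := E) h2 k i n)
    simp only [mul_add, map_add] at hs
    cases n with
    | zero =>
      have h0 : coeff 0 (X ^ (j : ℕ) * ((transferSeries N E φ ψ ((k : ℤ) + 1) ((i : ℤ) - 1)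
          (((0 : ℕ) : ℤ) - 1) : ℂ⟦X⟧) * X)) = 0 := by simp
      rw [h0, add_zero] at hs
      change w₁ ^ (0 + 1) * v (k + 1) i 0 j = w₃ * w₁ ^ 0 * v k i 0 j + 0
      simp only [v, transferVector]
      push_cast at hs ⊢
      rw [hs]
      linear_combination (a ^ k * θ⁻¹ ^ (j : ℕ) *
        coeff 0 (X ^ (j : ℕ) * (transferSeries N E φ ψ k i 0 : ℂ⟦X⟧))) * haw'
    | succ n =>
      rw [hshift] at hs
      change w₁ ^ (n + 1 + 1) * v (k + 1) i (n + 1) j =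
        w₃ * w₁ ^ (n + 1) * v k i (n + 1) j + (w₁ / w₃ * w₁ ^ n) * v (k + 1) ((i : ℤ) - 1) n j
      simp only [v, transferVector]
      push_cast at hs ⊢
      rw [add_sub_cancel_right] at hs
      rw [hs]
      generalize coeff (n + 1) (X ^ (j : ℕ) * (transferSeries N E φ ψ k i (n + 1) : ℂ⟦X⟧)) = A
      generalize coeff n (X ^ (j : ℕ) * (transferSeries N E φ ψ (k + 1) (i - 1) n : ℂ⟦X⟧)) = B
      generalize θ⁻¹ ^ (j : ℕ) = t
      linear_combination w₁ ^ (n + 1) * a ^ k * θ ^ (n + 1) * t * (A + B) * haw' -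
        w₁ ^ n * a ^ k * θ ^ n * t * B * haw + w₁ ^ n * a ^ k * θ ^ n * t * B * hθw
  · intro k i n
    simp only [Q]
    congr 2
    push_cast
    ring
  · intro n hn
    ext j
    have hj := j.2
    have hN : ((N - 1 : ℕ) : ℤ) = N - 1 := by
      rw [Nat.cast_sub (by omega)]; rfl
    -- At `k = 0`, `i = N - 1` both `φ` and `ψ` drop out. Since `E` is linear in `X`, the power has
    -- degree at most `n - N < n - j`, so the coefficient read off is zero.
    have hser : transferSeries N E φ ψ (0 : ℕ) (N - 1 : ℕ) n = E ^ (n - N) := by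
      rw [transferSeries, hN, ← zpow_natCast, Nat.cast_sub hn,
        show (n : ℤ) - ((N : ℤ) - 1) - 1 = n - N by ring]
      simp
    simp only [v, transferVector, Pi.zero_apply]
    rw [hser, Units.val_pow_eq_pow_val, hE, coeff_X_pow_mul', if_pos (by omega),
      coeff_one_add_C_mul_X_pow_of_lt e (by omega), mul_zero]
  · rw [Matrix.det_of_isLowerTriangular]
    · refine Finset.prod_eq_one fun i _ => ?_
      simp only [Matrix.of_apply, v, transferVector]
      rw [coeff_X_pow_mul', if_pos le_rfl, Nat.sub_self, coeff_zero_eq_constantCoeff_apply,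
        transferSeries]
      simp only [Units.val_mul, map_mul, constantCoeff_zpow_of_eq_one hcE,
        constantCoeff_zpow_of_eq_one hψ]
      simp [hθ0]
    · intro i j hij
      have : ¬ (j : ℕ) ≤ i := by
        have : i < j := by simpa using hij
        simpa using this
      simp only [Matrix.of_apply, v, transferVector]
      rw [coeff_X_pow_mul', if_neg this, mul_zero]

end TransferVectors

/-! ### From binomial polynomials to Toeplitz determinants -/

section ToeplitzDeterminants

open PowerSeries

/-- The functional `f ↦ [X ^ n] (f * G)`. -/
noncomputable def coeffMul (n : ℕ) (G : ℂ⟦X⟧) : ℂ⟦X⟧ →ₗ[ℂ] ℂ :=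
  (coeff n).comp (LinearMap.mulRight ℂ G)

lemma coeffMul_apply (n : ℕ) (G f : ℂ⟦X⟧) : coeffMul n G f = coeff n (f * G) := rfl

/-- Row operations which multiply the `i`-th row of a Toeplitz-like matrix by `(1 + ε X) ^ i`. -/
lemma det_coeff_pow_mul (ε : ℂ) {n : ℕ} (m : ℕ) (F : Fin n → ℂ⟦X⟧) :
    Matrix.det (Matrix.of fun i j : Fin n => coeff (m + i : ℕ) ((1 + C ε * X) ^ (i : ℕ) * F j)) =
      Matrix.det (Matrix.of fun i j : Fin n => coeff (m + i : ℕ) (F j)) := by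
  have h := det_pow_mul_pow_left (fun j : Fin n => coeffMul (m + (n - 1)) (F j)) 1 X 1 ε
  rw [one_pow, one_mul] at h
  have key : ∀ (i : Fin n) (f : ℂ⟦X⟧),
      coeff (m + (n - 1)) (X ^ (n - 1 - (i : ℕ)) * f) = coeff (m + i : ℕ) f := by
    intro i f
    rw [show m + (n - 1) = (m + i) + (n - 1 - (i : ℕ)) by omega, coeff_X_pow_mul]
  rw [← Matrix.det_transpose, ← Matrix.det_transpose
    (Matrix.of fun i j : Fin n => coeff (m + i : ℕ) (F j))]
  convert h using 2
  · ext j i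
    simp only [Matrix.transpose_apply, Matrix.of_apply, coeffMul_apply]
    rw [← key, one_smul, smul_eq_C_mul]
    congr 1
    ring
  · ext j i
    simp only [Matrix.transpose_apply, Matrix.of_apply, coeffMul_apply]
    rw [← key, one_pow, one_mul]

/-- Column operations only: in the monomials `X ^ j * 1 ^ (N - 1 - j)` replace `1` by `1 - X`, then
`X` by `x X + (1 - X) = 1 - (1 - x) X`. The second substitution produces the power of `x`. -/
lemma det_binomialPoly_eq_toeplitz (N b d : ℕ) (x : ℂ) :
    Matrix.det (Matrix.of fun i j : Fin N =>
        (binomialPoly (1 - (d : ℂ) - (j : ℕ)) ((b : ℂ) + 1 + (j : ℕ)) (d + i)).eval (1 - x)) =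
      x ^ (N * (N - 1) / 2) * Matrix.det (Matrix.of fun i j : Fin N => coeff (d + i : ℕ)
        (X ^ (j : ℕ) * ((linUnit (1 - x) ^ ((d : ℤ) - 1) * linUnit 1 ^ (-((N : ℤ) + b)) : ℂ⟦X⟧ˣ) :
          ℂ⟦X⟧))) := by
  set G := (linUnit (1 - x) ^ ((d : ℤ) - 1) * linUnit 1 ^ (-((N : ℤ) + b)) : ℂ⟦X⟧ˣ) with hG
  have h1 := det_pow_mul_pow_left (fun i : Fin N => coeffMul (d + i : ℕ) (G : ℂ⟦X⟧))
    X (linUnit 1 : ℂ⟦X⟧) x 1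
  have h2 := det_pow_mul_pow_right (fun i : Fin N => coeffMul (d + i : ℕ) (G : ℂ⟦X⟧))
    X 1 1 (-1)
  have e1 : (x • X + (1 : ℂ) • (linUnit 1 : ℂ⟦X⟧)) = (linUnit (1 - x) : ℂ⟦X⟧) := by
    rw [val_linUnit, val_linUnit, one_smul, smul_eq_C_mul, map_sub, map_one]
    ring
  have e2 : ((1 : ℂ) • (1 : ℂ⟦X⟧) + (-1 : ℂ) • X) = (linUnit 1 : ℂ⟦X⟧) := by
    rw [val_linUnit, one_smul, neg_one_smul, map_one]
    ring
  rw [e1] at h1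
  rw [e2, one_pow, one_mul] at h2
  rw [h2] at h1
  convert h1 using 2
  · ext i j
    simp only [Matrix.of_apply, coeffMul_apply]
    have hp : (1 - (d : ℂ) - (j : ℕ)) = ((1 - d - (j : ℕ) : ℤ) : ℂ) := by push_cast; rfl
    have hq : ((b : ℂ) + 1 + (j : ℕ)) = ((b + 1 + (j : ℕ) : ℤ) : ℂ) := by push_cast; rfl
    rw [hp, hq, ← coeff_linUnit_zpow_mul]
    congr 1
    rw [← Units.val_pow_eq_pow_val, ← Units.val_pow_eq_pow_val, ← Units.val_mul, ← Units.val_mul,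
      Units.val_inj, hG, ← zpow_natCast, ← zpow_natCast, mul_mul_mul_comm, ← zpow_add, ← zpow_add]
    have hj := j.2
    rw [Nat.cast_sub (by omega), Nat.cast_sub (by omega)]
    congr 2 <;> push_cast <;> ring
  · simp only [coeffMul_apply, one_pow, mul_one]

/-- Row operations remove the factors `(1 - X) ^ i`, and the column substitution `X ↦ 1 - x X`
produces the power of `-x`; its sign is the sign in the `d × d` formula. -/
lemma det_binomialPoly_eq_toeplitz' (N b d : ℕ) (x : ℂ) :
    Matrix.det (Matrix.of fun i j : Fin d =>
        (binomialPoly ((d : ℂ) - 1 - (j : ℕ)) ((b : ℂ) + 1 - (i : ℕ)) (N + i)).eval x) =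
      (-x) ^ (d * (d - 1) / 2) * Matrix.det (Matrix.of fun i j : Fin d => coeff (N + i : ℕ)
        (X ^ (j : ℕ) * ((linUnit x ^ (1 - (d : ℤ)) * linUnit 1 ^ (-((b : ℤ) + 1)) : ℂ⟦X⟧ˣ) :
          ℂ⟦X⟧))) := by
  set K := (linUnit x ^ (1 - (d : ℤ)) * linUnit 1 ^ (-((b : ℤ) + 1)) : ℂ⟦X⟧ˣ) with hK
  have h1 := det_pow_mul_pow_left
    (fun i : Fin d => coeffMul (N + i : ℕ) ((linUnit 1 ^ (i : ℕ) * K : ℂ⟦X⟧ˣ) : ℂ⟦X⟧))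
    X 1 (-x) 1
  have e1 : ((-x) • X + (1 : ℂ) • (1 : ℂ⟦X⟧)) = (linUnit x : ℂ⟦X⟧) := by
    rw [val_linUnit, one_smul, smul_eq_C_mul, map_neg]
    ring
  have e2 : (linUnit 1 : ℂ⟦X⟧) = 1 + C (-1) * X := by
    rw [val_linUnit, map_neg]
    ring
  rw [e1] at h1
  rw [← det_coeff_pow_mul (-1)]
  convert h1 using 3
  · ext i j
    simp only [coeffMul_apply]
    have hp : ((d : ℂ) - 1 - (j : ℕ)) = ((d - 1 - (j : ℕ) : ℤ) : ℂ) := by push_cast; rfl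
    have hq : ((b : ℂ) + 1 - (i : ℕ)) = ((b + 1 - (i : ℕ) : ℤ) : ℂ) := by push_cast; rfl
    rw [hp, hq, ← coeff_linUnit_zpow_mul]
    congr 1
    rw [one_pow, mul_one, ← Units.val_pow_eq_pow_val, ← Units.val_mul,
      Units.val_inj, hK, ← zpow_natCast, ← zpow_natCast, mul_left_comm (linUnit 1 ^ _),
      ← mul_assoc, ← zpow_add, ← zpow_add]
    congr 2 <;> ring
  · ext i j
    simp only [Matrix.of_apply, coeffMul_apply, one_pow, mul_one]
    rw [Units.val_mul (linUnit 1 ^ (i : ℕ)) K, Units.val_pow_eq_pow_val, e2]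
    congr 1
    ring

lemma coeff_linUnit_neg (z : ℂ) (p q : ℤ) (n : ℕ) :
    coeff n ((linUnit (-z) ^ p * linUnit (-1) ^ q : ℂ⟦X⟧ˣ) : ℂ⟦X⟧) =
      (-1) ^ n * coeff n ((linUnit z ^ p * linUnit 1 ^ q : ℂ⟦X⟧ˣ) : ℂ⟦X⟧) := by
  have h : ∀ z : ℂ, linUnit (-z) = Units.map (rescale (-1 : ℂ) : ℂ⟦X⟧ →* ℂ⟦X⟧) (linUnit z) := by
    intro z
    ext1
    simp only [Units.coe_map, MonoidHom.coe_coe, val_linUnit, map_sub, map_one, map_mul]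
    have hC : rescale (-1 : ℂ) (C z) = C z := by
      ext n
      rw [coeff_rescale, coeff_C]
      split_ifs with h <;> simp [h]
    rw [rescale_X, hC]
    simp
  rw [h z, h 1, ← map_zpow, ← map_zpow, ← map_mul, Units.coe_map]
  exact coeff_rescale _ _ _

/-- The complementary determinant, after the change of sign of the variable. -/
lemma det_toeplitz_linUnit_complement (N b d : ℕ) (x : ℂ) :
    Matrix.det (Matrix.of fun i j : Fin N => coeff (d + i : ℕ)
        (X ^ (j : ℕ) * ((linUnit (-x) ^ ((d : ℤ) - 1) * linUnit (-1) ^ ((b : ℤ) + 1) : ℂ⟦X⟧ˣ) :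
          ℂ⟦X⟧))) =
      Matrix.det (Matrix.of fun i j : Fin d => coeff (N + i : ℕ)
        (X ^ (j : ℕ) * ((linUnit x ^ (1 - (d : ℤ)) * linUnit 1 ^ (-((b : ℤ) + 1)) : ℂ⟦X⟧ˣ) :
          ℂ⟦X⟧))) := by
  set K := (linUnit x ^ (1 - (d : ℤ)) * linUnit 1 ^ (-((b : ℤ) + 1)) : ℂ⟦X⟧ˣ) with hK
  have hinv : (linUnit (-x) ^ ((d : ℤ) - 1) * linUnit (-1) ^ ((b : ℤ) + 1)) *
      (linUnit (-x) ^ (1 - (d : ℤ)) * linUnit (-1) ^ (-((b : ℤ) + 1))) = 1 := by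
    rw [mul_mul_mul_comm, ← zpow_add, ← zpow_add]
    simp
  have h0 : ∀ z, constantCoeff (linUnit z : ℂ⟦X⟧) = 1 := fun z => by simp
  rw [det_toeplitz_eq_det_toeplitz_inv _
    ((linUnit (-x) ^ (1 - (d : ℤ)) * linUnit (-1) ^ (-((b : ℤ) + 1)) : ℂ⟦X⟧ˣ) : ℂ⟦X⟧)
    (by rw [← Units.val_mul, hinv, Units.val_one])
    (by rw [Units.val_mul, map_mul, constantCoeff_zpow_of_eq_one (h0 _),
          constantCoeff_zpow_of_eq_one (h0 _), one_mul])]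
  have hent : (Matrix.of fun i j : Fin d => coeff (N + i : ℕ) (X ^ (j : ℕ) *
      ((linUnit (-x) ^ (1 - (d : ℤ)) * linUnit (-1) ^ (-((b : ℤ) + 1)) : ℂ⟦X⟧ˣ) : ℂ⟦X⟧))) =
      Matrix.of fun i j : Fin d => ((-1) ^ N * (-1) ^ (i : ℕ)) *
        (Matrix.of fun i j : Fin d => (-1) ^ (j : ℕ) *
          (Matrix.of fun i j : Fin d => coeff (N + i : ℕ) (X ^ (j : ℕ) * (K : ℂ⟦X⟧))) i j) i j := by
    ext i j
    simp only [Matrix.of_apply, coeff_X_pow_mul']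
    split_ifs with hj
    · rw [coeff_linUnit_neg, ← hK]
      obtain ⟨m, hm⟩ := Nat.exists_eq_add_of_le hj
      rw [hm, Nat.add_sub_cancel_left, ← pow_add, hm, ← mul_assoc, ← pow_add,
        show (j : ℕ) + m + j = m + 2 * j by ring, pow_add, pow_mul]
      simp
    · simp
  rw [hent]
  refine (congrArg _ (Matrix.det_mul_column _ _)).trans ?_
  refine (congrArg (fun z => _ * (_ * z)) (Matrix.det_mul_row _ _)).trans ?_
  have hc : (∏ i : Fin d, (-1 : ℂ) ^ (i : ℕ)) * ∏ i : Fin d, (-1 : ℂ) ^ (i : ℕ) = 1 := by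
    rw [← Finset.prod_mul_distrib]
    refine Finset.prod_eq_one fun i _ => ?_
    rw [← mul_pow]
    simp
  -- The sign of the duality cancels against the sign of the substitution `X ↦ -X`.
  have hs : ((-1 : ℂ) ^ N) ^ d * (-1) ^ (N * d) = 1 := by
    rw [← pow_mul, ← mul_pow]
    simp
  rw [Finset.prod_mul_distrib, Finset.prod_const, Finset.card_univ, Fintype.card_fin]
  generalize Matrix.det (Matrix.of fun i j : Fin d =>
    coeff (N + i : ℕ) (X ^ (j : ℕ) * (K : ℂ⟦X⟧))) = D
  linear_combination D * (((-1 : ℂ) ^ N) ^ d * (-1) ^ (N * d)) * hc + D * hs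

end ToeplitzDeterminants

/-! ### The two Toeplitz determinants for the partition function -/

section PartitionFunction

open PowerSeries

theorem homPartitionFunction_eq_toeplitz {L M N : ℕ} (hNL : N ≤ L) {α Δ u w₁ : ℂ}
    (hα : α ≠ 0) (hu : u ≠ 0) (hw₁ : w₁ = α / Δ * (u - 1 / u)) (hw₁0 : w₁ ≠ 0) :
    homPartitionFunction L M N α Δ u =
      (w₁ ^ L) ^ M * ((u / α / w₁) ^ M) ^ N * ((w₁ * (u / α))⁻¹ ^ (L - N)) ^ N *
        Matrix.det (Matrix.of fun i j : Fin N => coeff (L - N + i : ℕ) (X ^ (j : ℕ) *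
          ((linUnit (1 - u ^ 2) ^ (((L - N : ℕ) : ℤ) - 1) * linUnit 1 ^ (-(M : ℤ)) : ℂ⟦X⟧ˣ) :
            ℂ⟦X⟧))) := by
  rw [homPartitionFunction_eq_det_coeff hNL hα hu hw₁ hw₁0 (E := linUnit (1 - u ^ 2))
    (φ := (linUnit 1)⁻¹) (ψ := 1) (e := u ^ 2 - 1)]
  · congr 3
    ext i j
    congr 2
    rw [transferSeries, one_zpow, mul_one, inv_zpow, ← zpow_neg]
    congr 3
    push_cast
    ring_nf
  · simp only [val_linUnit, map_sub, map_one]; ring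
  · have : (linUnit (1 - u ^ 2) : ℂ⟦X⟧) - C (u ^ 2) * X = (linUnit 1 : ℂ⟦X⟧) := by
      rw [val_linUnit, val_linUnit, map_sub]; ring
    rw [this, Units.inv_mul, Units.val_one]
  · have h := Units.mul_inv (linUnit 1)
    rw [val_linUnit, map_one] at h
    rw [Units.val_one]
    linear_combination h
  · simp

/-- With `φ = ψ = 1 + X` row `i` carries an extra factor `(1 + X) ^ i`, which row operations remove.
What is left is a genuine Toeplitz determinant, to which the duality applies. -/
theorem homPartitionFunction_eq_toeplitz_complement {L M N : ℕ} (hNL : N ≤ L) (hNM : N ≤ M)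
    {α Δ u w₁ : ℂ} (hα : α ≠ 0) (hu : u ≠ 0) (hw₁ : w₁ = α / Δ * (u - 1 / u)) (hw₁0 : w₁ ≠ 0) :
    homPartitionFunction L M N α Δ u =
      (w₁ ^ L) ^ M * ((u / α / w₁) ^ M) ^ N * ((w₁ * (u / α))⁻¹ ^ (L - N)) ^ N *
        Matrix.det (Matrix.of fun i j : Fin (L - N) => coeff (N + i : ℕ) (X ^ (j : ℕ) *
          ((linUnit (u ^ 2) ^ (1 - ((L - N : ℕ) : ℤ)) * linUnit 1 ^ (-(((M - N : ℕ) : ℤ) + 1)) :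
            ℂ⟦X⟧ˣ) : ℂ⟦X⟧))) := by
  have hlin : ((linUnit (-1) : ℂ⟦X⟧ˣ) : ℂ⟦X⟧) = 1 + C 1 * X := by
    rw [val_linUnit, map_neg]; ring
  rw [homPartitionFunction_eq_det_coeff hNL hα hu hw₁ hw₁0 (E := linUnit (-(u ^ 2)))
    (φ := linUnit (-1)) (ψ := linUnit (-1)) (e := u ^ 2)]
  · rw [← det_toeplitz_linUnit_complement, ← det_coeff_pow_mul 1]
    congr 3
    ext i j
    congr 1
    rw [← hlin, ← Units.val_pow_eq_pow_val, mul_left_comm, ← Units.val_mul, transferSeries]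
    congr 2
    rw [← zpow_natCast (linUnit (-1)), mul_left_comm, ← zpow_add, mul_assoc, ← zpow_add,
      Nat.cast_sub hNM]
    congr 2 <;> push_cast <;> ring
  · rw [val_linUnit, map_neg]; ring
  · rw [val_linUnit, val_linUnit, map_neg, map_neg, map_one]; ring
  · rw [hlin, map_one]; ring
  · simp

end PartitionFunction

/-! ### Evaluation of the two Hankel determinants -/

section Symbols

open Finset

lemma isOpen_ne_zero_ne_one : IsOpen {x : ℂ | x ≠ 0 ∧ x ≠ 1} :=
  isOpen_ne.inter isOpen_ne

lemma analyticOnNhd_zpow_mul_zpow_mul (e f : ℤ) {g : ℂ → ℂ} (hg : Differentiable ℂ g) :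
    AnalyticOnNhd ℂ (fun x => x ^ e * (x - 1) ^ f * g x) {x : ℂ | x ≠ 0 ∧ x ≠ 1} := by
  refine DifferentiableOn.analyticOnNhd (fun x hx => ?_) isOpen_ne_zero_ne_one
  have h1 : DifferentiableAt ℂ (fun x : ℂ => x ^ e) x := differentiableAt_zpow.2 (Or.inl hx.1)
  have h2 : DifferentiableAt ℂ (fun x : ℂ => (x - 1) ^ f) x :=
    (differentiableAt_id.sub_const 1).zpow (Or.inl (sub_ne_zero.2 hx.2))
  exact ((h1.mul h2).mul hg.differentiableAt).differentiableWithinAt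

/-- Each ladder step lowers the power of `x - 1` by one; the bracket has the shape of the contiguity
relations, with `l` chosen to match. -/
lemma eulerOp_zpow_mul_zpow_mul (e f : ℤ) {g : ℂ → ℂ} {g' x : ℂ} (hg : HasDerivAt g g' x)
    (h0 : x ≠ 0) (h1 : x ≠ 1) (l : ℂ) :
    eulerOp (fun x => x ^ e * (x - 1) ^ f * g x) x - l * (x ^ e * (x - 1) ^ f * g x) =
      x ^ e * (x - 1) ^ (f - 1) *
        ((e - l) * (x - 1) * g x + f * x * g x + x * (x - 1) * g') := by
  have hy : x - 1 ≠ 0 := sub_ne_zero.2 h1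
  have d1 := hasDerivAt_zpow e x (Or.inl h0)
  have d2 : HasDerivAt (fun x : ℂ => (x - 1) ^ f) (f * (x - 1) ^ (f - 1)) x :=
    (hasDerivAt_zpow f (x - 1) (Or.inl hy)).comp_sub_const x 1
  have d3 := (d1.mul d2).mul hg
  have d4 : deriv (fun x => x ^ e * (x - 1) ^ f * g x) x = _ := d3.deriv
  rw [eulerOp, d4]
  have e1 : x ^ e = x ^ (e - 1) * x := by rw [← zpow_add_one₀ h0]; simp
  have e2 : (x - 1) ^ f = (x - 1) ^ (f - 1) * (x - 1) := by rw [← zpow_add_one₀ hy]; simp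
  simp only [Pi.mul_apply]
  rw [e1, e2]
  ring

lemma hankelDet_const_mul (n : ℕ) (c : ℂ) (f : ℂ → ℂ) (x : ℂ) :
    hankelDet n (fun x => c * f x) x = c ^ n * hankelDet n f x := by
  have h : ∀ k : ℕ, eulerOp^[k] (fun x => c * f x) = fun x => c * eulerOp^[k] f x := by
    intro k
    induction k with
    | zero => rfl
    | succ k ih =>
      rw [Function.iterate_succ_apply', Function.iterate_succ_apply', ih]
      funext y
      simp only [eulerOp]
      rw [deriv_const_mul_field]
      ring
  simp only [hankelDet, h]
  have := Matrix.det_smul (Matrix.of fun i j : Fin n => eulerOp^[(i : ℕ) + (j : ℕ)] f x) c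
  rw [Fintype.card_fin] at this
  rw [← this]
  rfl

lemma det_mul_zpow {n : ℕ} (c : ℂ) {y : ℂ} (hy : y ≠ 0) (k : ℤ) (A : ℕ → ℕ → ℂ) :
    Matrix.det (Matrix.of fun i j : Fin n => c * y ^ (k - (i : ℕ) - (j : ℕ)) * A i j) =
      (c * y ^ k) ^ n * ((y ^ (n * (n - 1) / 2))⁻¹) ^ 2 *
        Matrix.det (Matrix.of fun i j : Fin n => A i j) := by
  have h : (Matrix.of fun i j : Fin n => c * y ^ (k - (i : ℕ) - (j : ℕ)) * A i j) =
      Matrix.of fun i j : Fin n => (c * y ^ k * y⁻¹ ^ (i : ℕ)) *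
        (Matrix.of fun i j : Fin n => y⁻¹ ^ (j : ℕ) *
          (Matrix.of fun i j : Fin n => A i j) i j) i j := by
    ext i j
    simp only [Matrix.of_apply]
    rw [sub_sub, zpow_sub₀ hy, zpow_add₀ hy, zpow_natCast, zpow_natCast, inv_pow, inv_pow]
    field_simp
  have hp : ∏ i : Fin n, y⁻¹ ^ (i : ℕ) = (y ^ (n * (n - 1) / 2))⁻¹ := by
    rw [Fin.prod_univ_eq_prod_range (fun i => y⁻¹ ^ i), prod_pow_eq_pow_sum, sum_range_id, inv_pow]
  rw [h]
  refine (Matrix.det_mul_column _ _).trans ?_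
  refine (congrArg _ (Matrix.det_mul_row _ _)).trans ?_
  rw [prod_mul_distrib, hp, prod_const, card_univ, Fintype.card_fin]
  ring

lemma symbol₁_eq (N b d : ℕ) (x : ℂ) :
    symbol₁ (N + d) (N + b) N x = ((N + b).choose N : ℂ)⁻¹ *
      (x ^ (-((N : ℤ) + b + 1)) * (x - 1) ^ ((b : ℤ) + d - 1) *
        (binomialPoly ((d : ℂ) - 1) ((b : ℂ) + 1) N).eval x) := by
  have h := choose_mul_hypergeometric (Nat.le_add_right N b) ((d : ℂ) - 1) x
  have hc : ((N + b).choose N : ℂ) ≠ 0 :=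
    Nat.cast_ne_zero.2 (Nat.choose_pos (Nat.le_add_right N b)).ne'
  rw [show (((N + b : ℕ) : ℂ) - N + 1) = b + 1 by push_cast; ring] at h
  rw [← h, symbol₁, show (((N + d : ℕ) : ℂ) - N - 1) = d - 1 by push_cast; ring,
    show ((N + b : ℕ) : ℤ) + (N + d : ℕ) - 2 * N - 1 = b + d - 1 by push_cast; ring,
    zpow_neg, show (N : ℤ) + b + 1 = ((N + b + 1 : ℕ) : ℤ) by push_cast; rfl, zpow_natCast]
  field_simp

lemma symbol₂_eq (N b d : ℕ) (x : ℂ) :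
    symbol₂ (N + d) (N + b) N x = ((d + b).choose d : ℂ)⁻¹ *
      (x ^ ((b : ℤ) - d + 1) * (x - 1) ^ (-((d : ℤ) + b + 1)) *
        (binomialPoly (1 - (d : ℂ)) ((b : ℂ) + 1) d).eval (1 - x)) := by
  have h := choose_mul_hypergeometric (Nat.le_add_right d b) (1 - (d : ℂ)) (1 - x)
  have hc : ((d + b).choose d : ℂ) ≠ 0 :=
    Nat.cast_ne_zero.2 (Nat.choose_pos (Nat.le_add_right d b)).ne'
  rw [show (((d + b : ℕ) : ℂ) - d + 1) = b + 1 by push_cast; ring] at h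
  -- The upper parameters are exchanged so that `-d` plays the terminating role; the other one, `1 -
  -- d`, is positive when `d = 0`.
  have hs : ∀ p q r z : ℂ, ordinaryHypergeometric p q r z = ordinaryHypergeometric q p r z := by
    intro p q r z
    simp only [ordinaryHypergeometric]
    rw [ordinaryHypergeometricSeries_symm]
  rw [← h, symbol₂, hs, show (-((N + d : ℕ) : ℂ) + N + 1) = 1 - d by push_cast; ring,
    show (-((N + d : ℕ) : ℂ) + N) = -d by push_cast; ring,
    show (-((N + d : ℕ) : ℂ) - (N + b : ℕ) + 2 * N) = -((d + b : ℕ) : ℂ) by push_cast; ring,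
    show ((N + b : ℕ) : ℤ) - (N + d : ℕ) + 1 = b - d + 1 by push_cast; ring,
    show ((N + b : ℕ) : ℤ) + (N + d : ℕ) - 2 * N + 1 = d + b + 1 by push_cast; ring, zpow_neg]
  field_simp

/-- The ladder family has parameters `p = d - 1 - j`, `q = b + 1 - i`, degree `N + i` and exponent
`b + d - 1 - i - j` of `x - 1`. The shifts of `x ∂ₓ` come out independent of `j` for rows and of `i`
for columns, as the ladder argument requires. -/
theorem hankelDet_symbol₁ (N b d : ℕ) {x : ℂ} (h0 : x ≠ 0) (h1 : x ≠ 1) :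
    hankelDet d (symbol₁ (N + d) (N + b) N) x =
      ((N + b).choose N : ℂ)⁻¹ ^ d *
        ((∏ i ∈ range d, ∏ s ∈ range i, ((N : ℂ) + s + 1)) *
        (∏ i ∈ range d, ∏ s ∈ range i, ((N : ℂ) + b + d - 1 - s))) *
      ((x ^ (-((N : ℤ) + b + 1)) * (x - 1) ^ ((b : ℤ) + d - 1)) ^ d *
        (((x - 1) ^ (d * (d - 1) / 2))⁻¹) ^ 2) *
      Matrix.det (Matrix.of fun i j : Fin d =>
        (binomialPoly ((d : ℂ) - 1 - (j : ℕ)) ((b : ℂ) + 1 - (i : ℕ)) (N + i)).eval x) := by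
  have h := hankelDet_eq_mul_det isOpen_ne_zero_ne_one d
    (fun i j x => x ^ (-((N : ℤ) + b + 1)) * (x - 1) ^ ((b : ℤ) + d - 1 - i - j) *
      (binomialPoly ((d : ℂ) - 1 - j) ((b : ℂ) + 1 - i) (N + i)).eval x)
    (fun i => -((N : ℂ) + i + 1)) (fun j => (d : ℂ) - 2 - j)
    (fun i => (N : ℂ) + i + 1) (fun j => (N : ℂ) + b + d - 1 - j)
    (fun i j => analyticOnNhd_zpow_mul_zpow_mul _ _ (Polynomial.differentiable _))
    (fun i j x hx => ?_) (fun i j x hx => ?_) (show x ∈ {x : ℂ | x ≠ 0 ∧ x ≠ 1} from ⟨h0, h1⟩)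
  · rw [show symbol₁ (N + d) (N + b) N = _ from funext (symbol₁_eq N b d), hankelDet_const_mul]
    simp only [Nat.cast_zero, sub_zero, add_zero] at h
    rw [h, det_mul_zpow _ (sub_ne_zero.2 h1) _ fun i j =>
      (binomialPoly ((d : ℂ) - 1 - j) ((b : ℂ) + 1 - i) (N + i)).eval x]
    ring
  · rw [eulerOp_zpow_mul_zpow_mul _ _ (Polynomial.hasDerivAt _ x) hx.1 hx.2]
    have := congrArg (Polynomial.eval x) (eulerExpr_binomialPoly_raise_degree_lower
      ((d : ℂ) - 1 - j) ((b : ℂ) + 1 - i) (N + i))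
    simp only [Polynomial.eval_add, Polynomial.eval_mul, Polynomial.eval_C, Polynomial.eval_X,
      Polynomial.eval_sub, Polynomial.eval_one] at this
    push_cast at this ⊢
    rw [show (b : ℤ) + d - 1 - (i + 1) - j = b + d - 1 - i - j - 1 by ring,
      show (b : ℂ) + 1 - (i + 1) = b + 1 - i - 1 by ring, ← add_assoc N i 1]
    linear_combination (x ^ (-((N : ℤ) + b + 1)) * (x - 1) ^ ((b : ℤ) + d - 1 - i - j - 1)) * this
  · rw [eulerOp_zpow_mul_zpow_mul _ _ (Polynomial.hasDerivAt _ x) hx.1 hx.2]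
    have := congrArg (Polynomial.eval x) (eulerExpr_binomialPoly_lower_left
      ((d : ℂ) - 1 - j) ((b : ℂ) + 1 - i) (N + i))
    simp only [Polynomial.eval_add, Polynomial.eval_mul, Polynomial.eval_C, Polynomial.eval_X,
      Polynomial.eval_sub, Polynomial.eval_one] at this
    push_cast at this ⊢
    rw [show (b : ℤ) + d - 1 - i - (j + 1) = b + d - 1 - i - j - 1 by ring,
      show (d : ℂ) - 1 - (j + 1) = d - 1 - j - 1 by ring]
    linear_combination (x ^ (-((N : ℤ) + b + 1)) * (x - 1) ^ ((b : ℤ) + d - 1 - i - j - 1)) * this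

/-- Same method in the variable `1 - x`, with `p = 1 - d - j`, `q = b + 1 + j` and degree `d + i`;
the inner derivative makes all ladder constants negative. -/
theorem hankelDet_symbol₂ (N b d : ℕ) {x : ℂ} (h0 : x ≠ 0) (h1 : x ≠ 1) :
    hankelDet N (symbol₂ (N + d) (N + b) N) x =
      ((d + b).choose d : ℂ)⁻¹ ^ N *
        ((∏ i ∈ range N, ∏ s ∈ range i, (-((d : ℂ) + 1 + s))) *
        (∏ i ∈ range N, ∏ s ∈ range i, (-((b : ℂ) + 1 + s)))) *
      ((x ^ ((b : ℤ) - d + 1) * (x - 1) ^ (-((d : ℤ) + b + 1))) ^ N *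
        (((x - 1) ^ (N * (N - 1) / 2))⁻¹) ^ 2) *
      Matrix.det (Matrix.of fun i j : Fin N =>
        (binomialPoly (1 - (d : ℂ) - (j : ℕ)) ((b : ℂ) + 1 + (j : ℕ)) (d + i)).eval (1 - x)) := by
  have hder : ∀ (P : Polynomial ℂ) (x : ℂ),
      HasDerivAt (fun x => P.eval (1 - x)) (P.derivative.eval (1 - x) * -1) x := fun P x =>
    (P.hasDerivAt (1 - x)).comp x ((hasDerivAt_id x).const_sub 1)
  have h := hankelDet_eq_mul_det isOpen_ne_zero_ne_one N
    (fun i j x => x ^ ((b : ℤ) - d + 1) * (x - 1) ^ (-((d : ℤ) + b + 1) - i - j) *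
      (binomialPoly (1 - (d : ℂ) - j) ((b : ℂ) + 1 + j) (d + i)).eval (1 - x))
    (fun i => -((d : ℂ) + 1 + i)) (fun j => -((d : ℂ) + j))
    (fun i => -((d : ℂ) + 1 + i)) (fun j => -((b : ℂ) + 1 + j))
    (fun i j => analyticOnNhd_zpow_mul_zpow_mul _ _ fun x => (hder _ x).differentiableAt)
    (fun i j x hx => ?_) (fun i j x hx => ?_) (show x ∈ {x : ℂ | x ≠ 0 ∧ x ≠ 1} from ⟨h0, h1⟩)
  · rw [show symbol₂ (N + d) (N + b) N = _ from funext (symbol₂_eq N b d), hankelDet_const_mul]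
    simp only [Nat.cast_zero, sub_zero, add_zero] at h
    rw [h, det_mul_zpow _ (sub_ne_zero.2 h1) _ fun i j =>
      (binomialPoly (1 - (d : ℂ) - j) ((b : ℂ) + 1 + j) (d + i)).eval (1 - x)]
    ring
  · rw [eulerOp_zpow_mul_zpow_mul _ _ (hder _ x) hx.1 hx.2]
    have := congrArg (Polynomial.eval (1 - x)) (eulerExpr_binomialPoly_raise_degree
      (1 - (d : ℂ) - j) ((b : ℂ) + 1 + j) (d + i))
    simp only [Polynomial.eval_add, Polynomial.eval_mul, Polynomial.eval_C, Polynomial.eval_X,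
      Polynomial.eval_sub, Polynomial.eval_one] at this
    push_cast at this ⊢
    rw [show -((d : ℤ) + b + 1) - (i + 1) - j = -((d : ℤ) + b + 1) - i - j - 1 by ring,
      ← add_assoc d i 1]
    linear_combination
      -(x ^ ((b : ℤ) - d + 1) * (x - 1) ^ (-((d : ℤ) + b + 1) - i - j - 1)) * this
  · rw [eulerOp_zpow_mul_zpow_mul _ _ (hder _ x) hx.1 hx.2]
    have := congrArg (Polynomial.eval (1 - x)) (eulerExpr_binomialPoly_lower_left_raise_right
      (1 - (d : ℂ) - j) ((b : ℂ) + 1 + j) (d + i))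
    simp only [Polynomial.eval_add, Polynomial.eval_mul, Polynomial.eval_C, Polynomial.eval_X,
      Polynomial.eval_sub, Polynomial.eval_one] at this
    push_cast at this ⊢
    rw [show -((d : ℤ) + b + 1) - i - (j + 1) = -((d : ℤ) + b + 1) - i - j - 1 by ring,
      show (b : ℂ) + 1 + (j + 1) = b + 1 + j + 1 by ring,
      show 1 - (d : ℂ) - (j + 1) = 1 - d - j - 1 by ring]
    linear_combination
      -(x ^ ((b : ℤ) - d + 1) * (x - 1) ^ (-((d : ℤ) + b + 1) - i - j - 1)) * this

end Symbols

/-! ### Factorials and monomial prefactors -/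

section Prefactors

open Finset

lemma prod_Icc_one_eq_prod_range (n : ℕ) (f : ℕ → ℂ) :
    ∏ i ∈ Icc 1 n, f i = ∏ i ∈ range n, f (i + 1) := by
  induction n with
  | zero => simp
  | succ n ih => rw [prod_Icc_succ_top (by omega), ih, prod_range_succ]

lemma factorial_mul_prod_add (n i : ℕ) :
    (n.factorial : ℂ) * ∏ s ∈ range i, ((n : ℂ) + s + 1) = (n + i).factorial := by
  induction i with
  | zero => simp
  | succ i ih =>
    rw [prod_range_succ, ← mul_assoc, ih, ← add_assoc, Nat.factorial_succ]
    push_cast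
    ring

lemma factorial_sub_mul_prod_sub (n i : ℕ) (h : i ≤ n) :
    ((n - i).factorial : ℂ) * ∏ s ∈ range i, ((n : ℂ) - s) = n.factorial := by
  induction i with
  | zero => simp
  | succ i ih =>
    rw [← ih (by omega), prod_range_succ, show n - i = n - (i + 1) + 1 by omega,
      Nat.factorial_succ]
    have : ((n - (i + 1) + 1 : ℕ) : ℂ) = n - i := by
      rw [show n - (i + 1) + 1 = n - i by omega, Nat.cast_sub (by omega)]
    push_cast at this ⊢
    rw [this]
    ring

lemma natCast_factorial_ne_zero (n : ℕ) : (n.factorial : ℂ) ≠ 0 :=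
  Nat.cast_ne_zero.2 n.factorial_ne_zero

lemma prod_factorial_symbol₁ (N b d : ℕ) :
    (∏ i ∈ Icc 1 d, (((N + b).factorial : ℂ) * (N + b + i - 1).factorial) /
        (b.factorial * (N + b + d - 1).factorial * (N + i - 1).factorial)) *
      (((N + b).choose N : ℂ)⁻¹ ^ d *
        ((∏ i ∈ range d, ∏ s ∈ range i, ((N : ℂ) + s + 1)) *
        (∏ i ∈ range d, ∏ s ∈ range i, ((N : ℂ) + b + d - 1 - s)))) = 1 := by
  -- The factors do not cancel one by one: a quotient of these two factorials remains for each `i`,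
  -- and the product is `1` only after reflecting the index.
  have hrefl : ∏ i ∈ range d, ((N + b + i).factorial : ℂ) =
      ∏ i ∈ range d, ((N + b + d - 1 - i).factorial : ℂ) := by
    rw [← prod_range_reflect (fun i => ((N + b + i).factorial : ℂ))]
    refine prod_congr rfl fun i hi => ?_
    have := mem_range.1 hi
    rw [show N + b + (d - 1 - i) = N + b + d - 1 - i by omega]
  have hne : ∏ i ∈ range d, ((N + b + d - 1 - i).factorial : ℂ) ≠ 0 :=
    prod_ne_zero_iff.2 fun i _ => natCast_factorial_ne_zero _
  have hconst : ∀ c : ℂ, c ^ d = ∏ _i ∈ range d, c := fun c => by simp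
  rw [prod_Icc_one_eq_prod_range, hconst, ← prod_mul_distrib,
    ← prod_mul_distrib, ← prod_mul_distrib]
  refine Eq.trans ?_ ((congrArg (· / _) hrefl).trans (div_self hne))
  rw [← prod_div_distrib]
  refine prod_congr rfl fun i hi => ?_
  have hi := mem_range.1 hi
  have h1 := factorial_mul_prod_add N i
  have h2 := factorial_sub_mul_prod_sub (N + b + d - 1) i (by omega)
  have h3 : ((N + b).choose N : ℂ) * N.factorial * b.factorial = (N + b).factorial := by
    have := Nat.choose_mul_factorial_mul_factorial (Nat.le_add_right N b)
    rw [Nat.add_sub_cancel_left] at this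
    exact_mod_cast this
  have hcast : ((N + b + d - 1 : ℕ) : ℂ) = N + b + d - 1 := by
    rw [Nat.cast_sub (by omega)]; push_cast; ring
  rw [hcast] at h2
  have hc : ((N + b).choose N : ℂ) ≠ 0 :=
    Nat.cast_ne_zero.2 (Nat.choose_pos (Nat.le_add_right N b)).ne'
  rw [← add_assoc, Nat.add_sub_cancel, ← add_assoc, Nat.add_sub_cancel, ← h1, ← h2, ← h3]
  have hA : ∏ s ∈ range i, ((N : ℂ) + s + 1) ≠ 0 := by
    intro h; rw [h, mul_zero] at h1; exact natCast_factorial_ne_zero _ h1.symm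
  have hB : ∏ s ∈ range i, ((N : ℂ) + b + d - 1 - s) ≠ 0 := by
    intro h; rw [h, mul_zero] at h2; exact natCast_factorial_ne_zero _ h2.symm
  have f1 := natCast_factorial_ne_zero N
  have f2 := natCast_factorial_ne_zero b
  have f3 := natCast_factorial_ne_zero (N + b + d - 1 - i)
  field_simp

lemma prod_factorial_symbol₂ (N b d : ℕ) :
    (∏ i ∈ Icc 1 N, (((d + b).factorial : ℂ) * b.factorial) /
        (b.factorial * (N + d - i).factorial * (N + b - i).factorial)) *
      (((d + b).choose d : ℂ)⁻¹ ^ N *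
        ((∏ i ∈ range N, ∏ s ∈ range i, (-((d : ℂ) + 1 + s))) *
        (∏ i ∈ range N, ∏ s ∈ range i, (-((b : ℂ) + 1 + s))))) = 1 := by
  have hsplit : ∏ i ∈ Icc 1 N, (((d + b).factorial : ℂ) * b.factorial) /
        (b.factorial * (N + d - i).factorial * (N + b - i).factorial) =
      ∏ i ∈ range N, ((d + b).factorial : ℂ) / ((d + i).factorial * (b + i).factorial) := by
    rw [prod_Icc_one_eq_prod_range, ← prod_range_reflect]
    refine prod_congr rfl fun i hi => ?_
    have := mem_range.1 hi
    rw [show N + d - (N - 1 - i + 1) = d + i by omega,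
      show N + b - (N - 1 - i + 1) = b + i by omega]
    have f2 := natCast_factorial_ne_zero b
    field_simp
  have hconst : ∀ c : ℂ, c ^ N = ∏ _i ∈ range N, c := fun c => by simp
  rw [hsplit, hconst, ← prod_mul_distrib, ← prod_mul_distrib, ← prod_mul_distrib]
  refine prod_eq_one fun i _ => ?_
  have h1 := factorial_mul_prod_add d i
  have h2 := factorial_mul_prod_add b i
  have h3 : ((d + b).choose d : ℂ) * d.factorial * b.factorial = (d + b).factorial := by
    have := Nat.choose_mul_factorial_mul_factorial (Nat.le_add_right d b)
    rw [Nat.add_sub_cancel_left] at this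
    exact_mod_cast this
  have hc : ((d + b).choose d : ℂ) ≠ 0 :=
    Nat.cast_ne_zero.2 (Nat.choose_pos (Nat.le_add_right d b)).ne'
  have hneg : ∀ n : ℕ, ∏ s ∈ range i, (-((n : ℂ) + 1 + s)) =
      (-1) ^ i * ∏ s ∈ range i, ((n : ℂ) + s + 1) := by
    intro n
    have hconst : (-1 : ℂ) ^ i = ∏ _s ∈ range i, (-1 : ℂ) := by simp
    rw [hconst, ← prod_mul_distrib]
    exact prod_congr rfl fun s _ => by ring
  rw [hneg, hneg, ← h1, ← h2, ← h3]
  have hA : ∏ s ∈ range i, ((d : ℂ) + s + 1) ≠ 0 := by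
    intro h; rw [h, mul_zero] at h1; exact natCast_factorial_ne_zero _ h1.symm
  have hB : ∏ s ∈ range i, ((b : ℂ) + s + 1) ≠ 0 := by
    intro h; rw [h, mul_zero] at h2; exact natCast_factorial_ne_zero _ h2.symm
  have f1 := natCast_factorial_ne_zero d
  have f2 := natCast_factorial_ne_zero b
  have hs : ((-1 : ℂ) ^ i) * (-1) ^ i = 1 := by rw [← mul_pow]; simp
  field_simp
  rw [← pow_mul, mul_comm, pow_mul]
  simp

/-- Laurent monomials in the four variables on which the prefactors depend. -/
noncomputable def laurentMonomial (α Δ u y : ℂ) (k l m n : ℤ) : ℂ := α ^ k * Δ ^ l * u ^ m * y ^ n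

section LaurentMonomial

variable {α Δ u y : ℂ}

lemma laurentMonomial_mul (hα : α ≠ 0) (hΔ : Δ ≠ 0) (hu : u ≠ 0) (hy : y ≠ 0)
    (k l m n k' l' m' n' : ℤ) :
    laurentMonomial α Δ u y k l m n * laurentMonomial α Δ u y k' l' m' n' =
      laurentMonomial α Δ u y (k + k') (l + l') (m + m') (n + n') := by
  simp only [laurentMonomial]
  rw [zpow_add₀ hα, zpow_add₀ hΔ, zpow_add₀ hu, zpow_add₀ hy]
  ring

lemma laurentMonomial_zpow (k l m n e : ℤ) :
    laurentMonomial α Δ u y k l m n ^ e =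
      laurentMonomial α Δ u y (k * e) (l * e) (m * e) (n * e) := by
  simp only [laurentMonomial, mul_zpow, zpow_mul]

lemma laurentMonomial_pow (k l m n : ℤ) (e : ℕ) :
    laurentMonomial α Δ u y k l m n ^ e =
      laurentMonomial α Δ u y (k * e) (l * e) (m * e) (n * e) := by
  rw [← zpow_natCast, laurentMonomial_zpow]

lemma laurentMonomial_inv (k l m n : ℤ) :
    (laurentMonomial α Δ u y k l m n)⁻¹ =
      laurentMonomial α Δ u y (-k) (-l) (-m) (-n) := by
  rw [← zpow_neg_one, laurentMonomial_zpow]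
  simp

end LaurentMonomial

lemma two_mul_triangle (n : ℕ) : 2 * ((n * (n - 1) / 2 : ℕ) : ℤ) = n * (n - 1) := by
  have h : 2 * (n * (n - 1) / 2) = n * (n - 1) :=
    Nat.mul_div_cancel' (Nat.even_mul_pred_self n).two_dvd
  have h' : ((n * (n - 1) : ℕ) : ℤ) = n * (n - 1) := by
    cases n with
    | zero => simp
    | succ n => push_cast [Nat.add_sub_cancel]; ring
  exact_mod_cast (congrArg (Nat.cast : ℕ → ℤ) h).trans h'

lemma weight_prefactor_left (N b d : ℕ) {α Δ u : ℂ} (hα : α ≠ 0) (hΔ : Δ ≠ 0) (hu : u ≠ 0)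
    (hu1 : u ^ 2 - 1 ≠ 0) :
    ((α / Δ * (u - 1 / u)) ^ (N + d)) ^ (N + b) *
        ((u / α / (α / Δ * (u - 1 / u))) ^ (N + b)) ^ N *
        ((α / Δ * (u - 1 / u) * (u / α))⁻¹ ^ d) ^ N =
      α ^ (((N + b : ℕ) : ℤ) * ((N + d : ℕ) - 2 * N)) / Δ ^ (d * b) *
      u ^ (((N + d : ℕ) : ℤ) * (N + b : ℕ) - ((N + d : ℕ) - N) * ((N + d : ℕ) - N - 3)) *
      (((u ^ 2) ^ (-((N : ℤ) + b + 1)) * (u ^ 2 - 1) ^ ((b : ℤ) + d - 1)) ^ d *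
        (((u ^ 2 - 1) ^ (d * (d - 1) / 2))⁻¹) ^ 2) * (u ^ 2) ^ (d * (d - 1) / 2) := by
  -- All quantities become Laurent monomials in `α`, `Δ`, `u` and `y = u ^ 2 - 1`, so the identity
  -- reduces to four equations between exponents; the triangular number enters only through its
  -- double.
  have hT := two_mul_triangle d
  generalize d * (d - 1) / 2 = T at hT ⊢
  generalize hy : u ^ 2 - 1 = y at *
  have hw : α / Δ * (u - 1 / u) = laurentMonomial α Δ u y 1 (-1) (-1) 1 := by
    simp only [laurentMonomial, zpow_one, zpow_neg, ← hy]; field_simp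
  have hv : u / α = laurentMonomial α Δ u y (-1) 0 1 0 := by
    simp only [laurentMonomial, zpow_one, zpow_neg, zpow_zero]; field_simp
  have hx : u ^ 2 = laurentMonomial α Δ u y 0 0 2 0 := by
    simp only [laurentMonomial, zpow_zero]; norm_cast; ring
  have hyz : ∀ k : ℤ, y ^ k = laurentMonomial α Δ u y 0 0 0 k := fun k => by
    simp [laurentMonomial]
  have huz : ∀ k : ℤ, u ^ k = laurentMonomial α Δ u y 0 0 k 0 := fun k => by
    simp [laurentMonomial]
  have hαz : ∀ k : ℤ, α ^ k = laurentMonomial α Δ u y k 0 0 0 := fun k => by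
    simp [laurentMonomial]
  have hΔz : ∀ k : ℤ, Δ ^ k = laurentMonomial α Δ u y 0 k 0 0 := fun k => by
    simp [laurentMonomial]
  rw [hx, hw, hv, hyz, huz, hαz, ← zpow_natCast Δ, hΔz, ← zpow_natCast y, hyz]
  simp only [div_eq_mul_inv, laurentMonomial_inv, laurentMonomial_pow, laurentMonomial_zpow,
    laurentMonomial_mul hα hΔ hu hu1]
  push_cast
  congr 1
  · ring
  · ring
  · linear_combination -hT
  · linear_combination hT

lemma weight_prefactor_right (N b d : ℕ) {α Δ u : ℂ} (hα : α ≠ 0) (hΔ : Δ ≠ 0) (hu : u ≠ 0)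
    (hu1 : u ^ 2 - 1 ≠ 0) :
    ((α / Δ * (u - 1 / u)) ^ (N + d)) ^ (N + b) *
        ((u / α / (α / Δ * (u - 1 / u))) ^ (N + b)) ^ N *
        ((α / Δ * (u - 1 / u) * (u / α))⁻¹ ^ d) ^ N =
      α ^ (((N + b : ℕ) : ℤ) * ((N + d : ℕ) - 2 * N)) / Δ ^ (d * b) *
      u ^ (-(((N + d : ℕ) : ℤ) * ((N + b : ℕ) - 2 * N)) - N * (N + 1)) *
      (u ^ 2 - 1) ^ ((N + b) * (N + d)) *
      (((u ^ 2) ^ ((b : ℤ) - d + 1) * (u ^ 2 - 1) ^ (-((d : ℤ) + b + 1))) ^ N *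
        (((u ^ 2 - 1) ^ (N * (N - 1) / 2))⁻¹) ^ 2) * (u ^ 2) ^ (N * (N - 1) / 2) := by
  have hT := two_mul_triangle N
  generalize N * (N - 1) / 2 = T at hT ⊢
  generalize hy : u ^ 2 - 1 = y at *
  have hw : α / Δ * (u - 1 / u) = laurentMonomial α Δ u y 1 (-1) (-1) 1 := by
    simp only [laurentMonomial, zpow_one, zpow_neg, ← hy]; field_simp
  have hv : u / α = laurentMonomial α Δ u y (-1) 0 1 0 := by
    simp only [laurentMonomial, zpow_one, zpow_neg, zpow_zero]; field_simp
  have hx : u ^ 2 = laurentMonomial α Δ u y 0 0 2 0 := by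
    simp only [laurentMonomial, zpow_zero]; norm_cast; ring
  have hyz : ∀ k : ℤ, y ^ k = laurentMonomial α Δ u y 0 0 0 k := fun k => by
    simp [laurentMonomial]
  have huz : ∀ k : ℤ, u ^ k = laurentMonomial α Δ u y 0 0 k 0 := fun k => by
    simp [laurentMonomial]
  have hαz : ∀ k : ℤ, α ^ k = laurentMonomial α Δ u y k 0 0 0 := fun k => by
    simp [laurentMonomial]
  have hΔz : ∀ k : ℤ, Δ ^ k = laurentMonomial α Δ u y 0 k 0 0 := fun k => by
    simp [laurentMonomial]
  rw [hx, hw, hv, hyz, huz, hαz, ← zpow_natCast Δ, hΔz, ← zpow_natCast y, ← zpow_natCast y, hyz,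
    hyz]
  simp only [div_eq_mul_inv, laurentMonomial_inv, laurentMonomial_pow, laurentMonomial_zpow,
    laurentMonomial_mul hα hΔ hu hu1]
  push_cast
  congr 1
  · ring
  · ring
  · linear_combination -hT
  · linear_combination hT

end Prefactors

/-! ### Continuity in the spectral parameters -/

section Continuity

open Filter Topology

lemma continuousAt_vertexWeight (α Δ : ℂ) (l b t r : Bool) {v : ℂ} (hv : v ≠ 0) :
    ContinuousAt (fun v => vertexWeight α Δ v l b t r) v := by
  cases l <;> cases b <;> cases t <;> cases r <;> simp only [vertexWeight] <;>
    fun_prop (disch := assumption)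

lemma continuousAt_partitionFunction (L M N : ℕ) (α Δ : ℂ) {u : Fin L → ℂ} {ξ : Fin M → ℂ}
    (hu : ∀ j, u j ≠ 0) (hξ : ∀ k, ξ k ≠ 0) :
    ContinuousAt (fun p : (Fin L → ℂ) × (Fin M → ℂ) => partitionFunction L M N α Δ p.1 p.2)
      (u, ξ) := by
  refine tendsto_finsetSum _ fun C _ => tendsto_finsetProd _ fun j _ =>
    tendsto_finsetProd _ fun k _ => ?_
  have h1 : ContinuousAt (fun p : (Fin L → ℂ) × (Fin M → ℂ) => p.1 j / p.2 k) (u, ξ) := by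
    refine ContinuousAt.div ?_ ?_ (hξ k)
    · exact ((continuous_apply j).comp continuous_fst).continuousAt
    · exact ((continuous_apply k).comp continuous_snd).continuousAt
  exact (continuousAt_vertexWeight α Δ _ _ _ _ (v := u j / ξ k) (div_ne_zero (hu j) (hξ k))).comp
    (f := fun p : (Fin L → ℂ) × (Fin M → ℂ) => p.1 j / p.2 k) (x := (u, ξ)) h1

lemma continuousAt_homPartitionFunction (L M N : ℕ) (α Δ : ℂ) {u : ℂ} (hu : u ≠ 0) :
    ContinuousAt (homPartitionFunction L M N α Δ) u := by
  have h : Continuous fun v : ℂ => ((fun _ => v, fun _ => 1) : (Fin L → ℂ) × (Fin M → ℂ)) := by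
    fun_prop
  exact (continuousAt_partitionFunction L M N α Δ (u := fun _ => u) (ξ := fun _ => 1)
    (fun _ => hu) fun _ => one_ne_zero).comp
      (f := fun v : ℂ => ((fun _ => v, fun _ => 1) : (Fin L → ℂ) × (Fin M → ℂ))) h.continuousAt

lemma continuousAt_hankelDet {U : Set ℂ} {f : ℂ → ℂ} (hf : AnalyticOnNhd ℂ f U) (n : ℕ) {x : ℂ}
    (hx : x ∈ U) : ContinuousAt (hankelDet n f) x := by
  have h : Continuous fun A : Matrix (Fin n) (Fin n) ℂ => A.det := continuous_id.matrix_det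
  refine h.continuousAt.comp (f := fun x => Matrix.of fun i j : Fin n =>
    eulerOp^[(i : ℕ) + (j : ℕ)] f x) ?_
  exact tendsto_pi_nhds.2 fun i => tendsto_pi_nhds.2 fun j =>
    (eulerOp_iterate_analyticOnNhd hf _ x hx).continuousAt

lemma continuousAt_hankelDet_symbol₁ (N b d : ℕ) {x : ℂ} (h0 : x ≠ 0) :
    ContinuousAt (hankelDet d (symbol₁ (N + d) (N + b) N)) x := by
  -- For `d = 0` the exponent `b + d - 1` of `x - 1` may be negative, but the determinant is empty;
  -- for `d ≥ 1` it is non-negative, so the symbol is analytic at `x = 1` too.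
  obtain rfl | hd := d.eq_zero_or_pos
  · have : hankelDet 0 (symbol₁ (N + 0) (N + b) N) = fun _ => 1 := by
      funext y
      exact Matrix.det_fin_zero
    rw [this]
    exact continuousAt_const
  refine continuousAt_hankelDet (U := {x | x ≠ 0}) ?_ d h0
  rw [show symbol₁ (N + d) (N + b) N = _ from funext (symbol₁_eq N b d)]
  refine DifferentiableOn.analyticOnNhd (fun y hy => ?_) isOpen_ne
  have h1 : DifferentiableAt ℂ (fun x : ℂ => x ^ (-((N : ℤ) + b + 1))) y :=
    differentiableAt_zpow.2 (Or.inl hy)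
  have h2 : DifferentiableAt ℂ (fun x : ℂ => (x - 1) ^ ((b : ℤ) + d - 1)) y :=
    (differentiableAt_id.sub_const 1).zpow (Or.inr (by omega))
  exact (((h1.mul h2).mul (Polynomial.differentiable _).differentiableAt).const_mul
    _).differentiableWithinAt

end Continuity

/-! ### The two determinant formulas -/

section MainFormulas

open Finset Filter Topology

lemma emptyWeight_ne_zero {α Δ u : ℂ} (hα : α ≠ 0) (hΔ : Δ ≠ 0) (hu : u ≠ 0)
    (hu1 : u ^ 2 ≠ 1) : α / Δ * (u - 1 / u) ≠ 0 := by
  have : α / Δ * (u - 1 / u) = α * (u ^ 2 - 1) / (Δ * u) := by field_simp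
  rw [this]
  exact div_ne_zero (mul_ne_zero hα (sub_ne_zero.2 hu1)) (mul_ne_zero hΔ hu)

lemma homPartitionFunction_eq_hankelDet_symbol₁_of_ne (N b d : ℕ) {α Δ u : ℂ} (hα : α ≠ 0)
    (hΔ : Δ ≠ 0) (hu : u ≠ 0) (hu1 : u ^ 2 ≠ 1) :
    homPartitionFunction (N + d) (N + b) N α Δ u =
      (-1) ^ (d * (d - 1) / 2) *
      (∏ i ∈ Icc 1 d, (((N + b).factorial : ℂ) * (N + b + i - 1).factorial) /
        (b.factorial * (N + b + d - 1).factorial * (N + i - 1).factorial)) *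
      (α ^ (((N + b : ℕ) : ℤ) * ((N + d : ℕ) - 2 * N)) / Δ ^ (d * b)) *
      u ^ (((N + d : ℕ) : ℤ) * (N + b : ℕ) - ((N + d : ℕ) - N) * ((N + d : ℕ) - N - 3)) *
      hankelDet d (symbol₁ (N + d) (N + b) N) (u ^ 2) := by
  have hy : u ^ 2 - 1 ≠ 0 := sub_ne_zero.2 hu1
  have hw0 := emptyWeight_ne_zero hα hΔ hu hu1
  have hZ := homPartitionFunction_eq_toeplitz_complement (Nat.le_add_right N d)
    (Nat.le_add_right N b) hα hu rfl hw0
  rw [hZ, hankelDet_symbol₁ N b d (pow_ne_zero 2 hu) hu1, det_binomialPoly_eq_toeplitz',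
    Nat.add_sub_cancel_left, Nat.add_sub_cancel_left, weight_prefactor_left N b d hα hΔ hu hy,
    neg_pow (u ^ 2)]
  have hs : (-1 : ℂ) ^ (d * (d - 1) / 2) * (-1) ^ (d * (d - 1) / 2) = 1 := by
    rw [← mul_pow]; simp
  have key : ∀ s F G a v H X D : ℂ, s * s = 1 → F * G = 1 →
      a * v * H * X * D = s * F * a * v * (G * H * (s * X * D)) := by
    intro s F G a v H X D h1 h2
    linear_combination -(a * v * H * X * D) * (h1 + s * s * h2)
  exact key _ _ _ _ _ _ _ _ hs (prod_factorial_symbol₁ N b d)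

/-- Both sides are continuous at every `u ≠ 0` and agree on a punctured neighbourhood of it, which
covers `u = 1` and `u = -1`. -/
theorem homPartitionFunction_eq_hankelDet_symbol₁ (N b d : ℕ) {α Δ u : ℂ} (hα : α ≠ 0)
    (hΔ : Δ ≠ 0) (hu : u ≠ 0) :
    homPartitionFunction (N + d) (N + b) N α Δ u =
      (-1) ^ (d * (d - 1) / 2) *
      (∏ i ∈ Icc 1 d, (((N + b).factorial : ℂ) * (N + b + i - 1).factorial) /
        (b.factorial * (N + b + d - 1).factorial * (N + i - 1).factorial)) *
      (α ^ (((N + b : ℕ) : ℤ) * ((N + d : ℕ) - 2 * N)) / Δ ^ (d * b)) *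
      u ^ (((N + d : ℕ) : ℤ) * (N + b : ℕ) - ((N + d : ℕ) - N) * ((N + d : ℕ) - N - 3)) *
      hankelDet d (symbol₁ (N + d) (N + b) N) (u ^ 2) := by
  have hcont : ContinuousAt (fun v : ℂ => hankelDet d (symbol₁ (N + d) (N + b) N) (v ^ 2)) u :=
    (continuousAt_hankelDet_symbol₁ N b d (pow_ne_zero 2 hu)).comp (f := fun v : ℂ => v ^ 2)
      (continuous_pow 2).continuousAt
  have hfin : ({0, 1, -1} \ {u} : Set ℂ).Finite := (Set.toFinite _).subset Set.sdiff_subset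
  have hev : ∀ᶠ v in 𝓝[≠] u, v ≠ 0 ∧ v ^ 2 ≠ 1 := by
    filter_upwards [self_mem_nhdsWithin, mem_nhdsWithin_of_mem_nhds
      (hfin.isClosed.isOpen_compl.mem_nhds (x := u) (by simp))] with v hv hv'
    have hv0 : v ∉ ({0, 1, -1} : Set ℂ) := fun h => hv' ⟨h, hv⟩
    simp only [Set.mem_insert_iff, Set.mem_singleton_iff, not_or] at hv0
    exact ⟨hv0.1, fun h => (sq_eq_one_iff.1 h).elim hv0.2.1 hv0.2.2⟩
  refine tendsto_nhds_unique_of_eventuallyEq (l := 𝓝[≠] u)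
    ((continuousAt_homPartitionFunction _ _ N α Δ hu).tendsto.mono_left nhdsWithin_le_nhds)
    (ContinuousAt.tendsto (ContinuousAt.mul (ContinuousAt.mul continuousAt_const
      (continuousAt_zpow₀ u _ (Or.inl hu))) hcont) |>.mono_left nhdsWithin_le_nhds) ?_
  filter_upwards [hev] with v hv
  exact homPartitionFunction_eq_hankelDet_symbol₁_of_ne N b d hα hΔ hv.1 hv.2

theorem homPartitionFunction_eq_hankelDet_symbol₂ (N b d : ℕ) {α Δ u : ℂ} (hα : α ≠ 0)
    (hΔ : Δ ≠ 0) (hu : u ≠ 0) (hu1 : u ^ 2 ≠ 1) :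
    homPartitionFunction (N + d) (N + b) N α Δ u =
      (∏ i ∈ Icc 1 N, (((d + b).factorial : ℂ) * b.factorial) /
        (b.factorial * (N + d - i).factorial * (N + b - i).factorial)) *
      (α ^ (((N + b : ℕ) : ℤ) * ((N + d : ℕ) - 2 * N)) / Δ ^ (d * b)) *
      u ^ (-(((N + d : ℕ) : ℤ) * ((N + b : ℕ) - 2 * N)) - N * (N + 1)) *
      (u ^ 2 - 1) ^ ((N + b) * (N + d)) *
      hankelDet N (symbol₂ (N + d) (N + b) N) (u ^ 2) := by
  have hy : u ^ 2 - 1 ≠ 0 := sub_ne_zero.2 hu1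
  have hw0 := emptyWeight_ne_zero hα hΔ hu hu1
  have hZ := homPartitionFunction_eq_toeplitz (M := N + b) (Nat.le_add_right N d) hα hu rfl hw0
  rw [hZ, hankelDet_symbol₂ N b d (pow_ne_zero 2 hu) hu1, det_binomialPoly_eq_toeplitz,
    Nat.add_sub_cancel_left, weight_prefactor_right N b d hα hΔ hu hy,
    show -((N + b : ℕ) : ℤ) = -((N : ℤ) + b) by push_cast; rfl]
  have key : ∀ F G a v y H X D : ℂ, F * G = 1 →
      a * v * y * H * X * D = F * a * v * y * (G * H * (X * D)) := by
    intro F G a v y H X D h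
    linear_combination -(a * v * y * H * X * D) * h
  exact key _ _ _ _ _ _ _ _ (prod_factorial_symbol₂ N b d)

end MainFormulas
end FiveVertex

open FiveVertex

theorem theorem2 (L M N : ℕ) (hNL : N ≤ L) (hNM : N ≤ M)
    (α Δ u : ℂ) (hα : α ≠ 0) (hΔ : Δ ≠ 0) (hu : u ≠ 0) :
    -- the homogeneous limit of the partition function exists and is the homogeneous one
    Filter.Tendsto (fun p : (Fin L → ℂ) × (Fin M → ℂ) => partitionFunction L M N α Δ p.1 p.2)
      (nhds (fun _ => u, fun _ => 1)) (nhds (homPartitionFunction L M N α Δ u)) ∧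
    -- the `(L - N) × (L - N)` determinant; `x = u ^ 2`, `x ^ (LM / 2) = u ^ (LM)`
    homPartitionFunction L M N α Δ u =
      (-1) ^ ((L - N) * (L - N - 1) / 2) *
      (∏ i ∈ Finset.Icc 1 (L - N),
        ((M.factorial : ℂ) * (M + i - 1).factorial) /
          ((M - N).factorial * (M + L - N - 1).factorial * (N + i - 1).factorial)) *
      (α ^ ((M : ℤ) * (L - 2 * N)) / Δ ^ ((L - N) * (M - N))) *
      u ^ ((L : ℤ) * M - (L - N) * (L - N - 3)) *
      hankelDet (L - N) (symbol₁ L M N) (u ^ 2) ∧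
    -- the `N × N` determinant
    (u ^ 2 ≠ 1 →
      homPartitionFunction L M N α Δ u =
        (∏ i ∈ Finset.Icc 1 N,
          (((L + M - 2 * N).factorial : ℂ) * (M - N).factorial) /
            ((M - N).factorial * (L - i).factorial * (M - i).factorial)) *
        (α ^ ((M : ℤ) * (L - 2 * N)) / Δ ^ ((L - N) * (M - N))) *
        u ^ (-((L : ℤ) * (M - 2 * N)) - N * (N + 1)) * (u ^ 2 - 1) ^ (M * L) *
        hankelDet N (symbol₂ L M N) (u ^ 2)) := by
  obtain ⟨d, rfl⟩ := Nat.exists_eq_add_of_le hNL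
  obtain ⟨b, rfl⟩ := Nat.exists_eq_add_of_le hNM
  rw [Nat.add_sub_cancel_left, Nat.add_sub_cancel_left,
    show N + b + (N + d) - N - 1 = N + b + d - 1 by omega,
    show N + d + (N + b) - 2 * N = d + b by omega]
  exact ⟨continuousAt_partitionFunction _ _ N α Δ (fun _ => hu) fun _ => one_ne_zero,
    homPartitionFunction_eq_hankelDet_symbol₁ N b d hα hΔ hu,
    homPartitionFunction_eq_hankelDet_symbol₂ N b d hα hΔ hu⟩
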